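/- Let $k,\ell\ge 1$ be integers, and let $\varrho$ be the generalised Thue–Morse substitution $1\mapsto 1^k\bar 1^{\ell}$, $\bar 1\mapsto \bar 1^k 1^{\ell}$, where $\bar 1$ is identified with $-1$. Let $v=v_0v_1v_2\ldots$ be its one-sided fixed point with $v_0=1$, put $w_n=v_n$ for $n\ge 0$ and $w_n=v_{-n-1}$ for $n<0$, and let $\mathbb X\subset\{\pm1\}^{\mathbb Z}$ be the hull of $\varrho$, that is, the closure in the product topology of the set of all integer translates of $w$. For $x\in\mathbb X$ consider the Dirac comb $\omega=\sum_{n\in\mathbb Z}x_n\delta_n$ on $\mathbb R$ and its restrictions $\omega_N=\sum_{|n|\le N}x_n\delta_n$. The autocorrelation of $\omega$ is the vague limit, as $N\to\infty$, of $\frac{1}{2N+1}\,\omega_N*\widetilde{\omega_N}$, where $\widetilde{\mu}(g)=\overline{\mu(\widetilde g)}$ and $\widetilde g(t)=\overline{g(-t)}$ for continuous $g$ of compact support. Then there is a measure $\gamma$ on $\mathbb R$ such that, for every $x\in\mathbb X$, the autocorrelation of $\omega$ exists and equals $\gamma$. The Fourier transform $\widehat\gamma$ (in the sense of tempered distributions,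 with kernel $e^{-2\pi i k t}$) exists and is a uniquely determined positive measure on $\mathbb R$; hence $\widehat\gamma$ is the diffraction measure of the Dirac comb of every element of $\mathbb X$. The measure $\widehat\gamma$ is purely singular continuous: it is non-zero, has no atoms, and is singular with respect to Lebesgue measure. -/

import Mathlib

open scoped CompactlySupported SchwartzMap FourierTransform Topology
open MeasureTheory Filter

noncomputable section

/-- A complex (Radon) measure on the real line, possibly of infinite total variation: a linear
functional on the compactly supported continuous functions that is continuous for the inductive
limit topology, that is, bounded in the supremum norm on the functions supported in a fixed
compact set. -/
@[ext]
structure ComplexRadonMeasure where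
  toLinearMap : C_c(ℝ, ℂ) →ₗ[ℂ] ℂ
  bounded : ∀ K : Set ℝ, IsCompact K → ∃ C : ℝ, ∀ (g : C_c(ℝ, ℂ)) (M : ℝ),
    tsupport g ⊆ K → (∀ x, ‖g x‖ ≤ M) → ‖toLinearMap g‖ ≤ C * M

namespace ComplexRadonMeasure

instance : CoeFun ComplexRadonMeasure (fun _ => C_c(ℝ, ℂ) → ℂ) := ⟨fun μ => μ.toLinearMap⟩

/-- The measure `μ` has compact support: it vanishes on every test function whose support avoids
a certain compact set. -/
def CompactSupport (μ : ComplexRadonMeasure) : Prop :=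
  ∃ K : Set ℝ, IsCompact K ∧ ∀ g : C_c(ℝ, ℂ), Disjoint (tsupport g) K → μ g = 0

/-- The function `x ↦ conj (g (-x))`. -/
def flipFun (g : C_c(ℝ, ℂ)) : C_c(ℝ, ℂ) where
  toFun x := starRingEnd ℂ (g (-x))
  continuous_toFun := Complex.continuous_conj.comp (g.continuous_toFun.comp continuous_neg)
  hasCompactSupport' :=
    (g.hasCompactSupport.comp_homeomorph (Homeomorph.neg ℝ)).comp_left (map_zero _)

@[simp]
theorem flipFun_apply (g : C_c(ℝ, ℂ)) (x : ℝ) : flipFun g x = starRingEnd ℂ (g (-x)) := rfl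

/-- The function `y ↦ g (x + y)`. -/
def translateFun (x : ℝ) (g : C_c(ℝ, ℂ)) : C_c(ℝ, ℂ) where
  toFun y := g (x + y)
  continuous_toFun := g.continuous_toFun.comp (continuous_const.add continuous_id)
  hasCompactSupport' := g.hasCompactSupport.comp_homeomorph (Homeomorph.addLeft x)

@[simp]
theorem translateFun_apply (x : ℝ) (g : C_c(ℝ, ℂ)) (y : ℝ) : translateFun x g y = g (x + y) := rfl

theorem tsupport_flipFun (g : C_c(ℝ, ℂ)) : tsupport (flipFun g) ⊆ Neg.neg '' tsupport g := by
  have hc : IsClosed (Neg.neg '' tsupport g) := by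
    rw [Set.image_neg_eq_neg]; exact (isClosed_tsupport g).neg
  refine closure_minimal (fun x hx => ⟨-x, subset_tsupport _ ?_, neg_neg x⟩) hc
  intro h
  exact hx (by simp [h])

/-- The flipped-over measure, which sends `g` to the conjugate of `μ (flipFun g)`. -/
def flip (μ : ComplexRadonMeasure) : ComplexRadonMeasure where
  toLinearMap :=
    { toFun := fun g => starRingEnd ℂ (μ (flipFun g))
      map_add' := fun g h => by
        have : flipFun (g + h) = flipFun g + flipFun h := by ext x; simp
        rw [this, map_add, map_add]
      map_smul' := fun c g => by
        have : flipFun (c • g) = starRingEnd ℂ c • flipFun g := by ext x; simp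
        rw [this, map_smul]; simp }
  bounded := fun K hK => by
    obtain ⟨C, hC⟩ := μ.bounded (Neg.neg '' K) (hK.image continuous_neg)
    refine ⟨C, fun g M hg hM => ?_⟩
    have := hC (flipFun g) M ((tsupport_flipFun g).trans (Set.image_mono hg))
      (fun x => by simpa using hM (-x))
    simpa using this

theorem CompactSupport.flip {μ : ComplexRadonMeasure} (h : μ.CompactSupport) :
    μ.flip.CompactSupport := by
  obtain ⟨K, hK, h⟩ := h
  refine ⟨Neg.neg '' K, hK.image continuous_neg, fun g hg => ?_⟩
  have : μ (flipFun g) = 0 := h _ <| by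
    refine Set.disjoint_left.2 fun x hx hxK => ?_
    obtain ⟨y, hy, rfl⟩ := tsupport_flipFun g hx
    exact Set.disjoint_left.1 hg hy ⟨-y, hxK, neg_neg y⟩
  change starRingEnd ℂ (μ (flipFun g)) = 0
  simp [this]

theorem tsupport_translateFun (x : ℝ) (g : C_c(ℝ, ℂ)) :
    tsupport (translateFun x g) ⊆ (fun y => x + y) ⁻¹' tsupport g :=
  closure_minimal (fun _ hy => subset_tsupport _ hy)
    ((isClosed_tsupport g).preimage (continuous_const.add continuous_id))

/-- For a measure `ν` of compact support, the function `x ↦ ν (y ↦ g (x + y))`. -/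
def convFun (ν : ComplexRadonMeasure) (hν : ν.CompactSupport) (g : C_c(ℝ, ℂ)) : C_c(ℝ, ℂ) where
  toFun x := ν (translateFun x g)
  continuous_toFun := by
    refine Metric.continuous_iff.2 fun b ε hε => ?_
    set K : Set ℝ := (fun p : ℝ × ℝ => p.1 - p.2) '' (tsupport g ×ˢ Metric.closedBall b 1) with hKdef
    have hK : IsCompact K :=
      (g.hasCompactSupport.isCompact.prod (isCompact_closedBall b 1)).image
        (continuous_fst.sub continuous_snd)
    have hsub : ∀ a ∈ Metric.closedBall b 1, tsupport (translateFun a g) ⊆ K := fun a ha y hy =>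
      ⟨(a + y, a), ⟨tsupport_translateFun a g hy, ha⟩, by simp⟩
    obtain ⟨C, hC⟩ := ν.bounded K hK
    have hu : UniformContinuous g :=
      g.hasCompactSupport.uniformContinuous_of_continuous g.continuous_toFun
    obtain ⟨δ, hδ, hg⟩ := Metric.uniformContinuous_iff.1 hu (ε / (2 * (|C| + 1))) (by positivity)
    refine ⟨min δ 1, by positivity, fun a ha => ?_⟩
    have ha1 : a ∈ Metric.closedBall b 1 := (ha.trans_le (min_le_right _ _)).le
    have hd : ‖ν (translateFun a g - translateFun b g)‖ ≤ C * (ε / (2 * (|C| + 1))) := by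
      refine hC _ _ ?_ fun y => ?_
      · refine closure_minimal (fun y hy => ?_) hK.isClosed
        by_contra hyK
        have h1 : translateFun a g y = 0 :=
          image_eq_zero_of_notMem_tsupport fun h => hyK (hsub a ha1 h)
        have h2 : translateFun b g y = 0 :=
          image_eq_zero_of_notMem_tsupport fun h =>
            hyK (hsub b (Metric.mem_closedBall_self zero_le_one) h)
        exact hy (by rw [CompactlySupportedContinuousMap.sub_apply, h1, h2, sub_zero])
      · have hlt : dist (a + y) (b + y) < δ := by
          rw [dist_add_right]; exact ha.trans_le (min_le_left _ _)
        have := (hg hlt).le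
        rwa [dist_eq_norm] at this
    rw [dist_eq_norm, ← map_sub]
    refine hd.trans_lt ?_
    have hpos : 0 < ε / (2 * (|C| + 1)) := by positivity
    calc C * (ε / (2 * (|C| + 1))) ≤ (|C| + 1) * (ε / (2 * (|C| + 1))) := by
          gcongr; linarith [le_abs_self C]
      _ = ε / 2 := by field_simp
      _ < ε := by linarith
  hasCompactSupport' := by
    have hν' := hν
    obtain ⟨K, hK, h⟩ := hν'
    refine HasCompactSupport.intro
      (K := (fun p : ℝ × ℝ => p.1 - p.2) '' (tsupport g ×ˢ K))
      ((g.hasCompactSupport.isCompact.prod hK).image (continuous_fst.sub continuous_snd))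
      fun x hx => h _ (Set.disjoint_left.2 fun y hy hyK => hx ?_)
    exact ⟨(x + y, y), ⟨tsupport_translateFun x g hy, hyK⟩, by simp⟩

@[simp]
theorem convFun_apply (ν : ComplexRadonMeasure) (hν : ν.CompactSupport) (g : C_c(ℝ, ℂ)) (x : ℝ) :
    convFun ν hν g x = ν (translateFun x g) := rfl

/-- The convolution `(μ * ν) (g) = ∫ ∫ g (x + y) dν(y) dμ(x)`, for `ν` of compact support. -/
def conv (μ ν : ComplexRadonMeasure) (hν : ν.CompactSupport) : ComplexRadonMeasure where
  toLinearMap :=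
    { toFun := fun g => μ (convFun ν hν g)
      map_add' := fun g h => by
        have : convFun ν hν (g + h) = convFun ν hν g + convFun ν hν h := by
          ext x
          have : translateFun x (g + h) = translateFun x g + translateFun x h := by ext y; simp
          simp [this]
        rw [this, map_add]
      map_smul' := fun c g => by
        have : convFun ν hν (c • g) = c • convFun ν hν g := by
          ext x
          have : translateFun x (c • g) = c • translateFun x g := by ext y; simp
          simp [this]
        rw [this, map_smul, RingHom.id_apply] }
  bounded := fun L hL => by
    have hν' := hν
    obtain ⟨K, hK, h⟩ := hν'
    set A : Set ℝ := (fun p : ℝ × ℝ => p.1 - p.2) '' (L ×ˢ K)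
    have hA : IsCompact A := (hL.prod hK).image (continuous_fst.sub continuous_snd)
    set B : Set ℝ := (fun p : ℝ × ℝ => p.1 - p.2) '' (L ×ˢ A)
    have hB : IsCompact B := (hL.prod hA).image (continuous_fst.sub continuous_snd)
    obtain ⟨C₁, h₁⟩ := μ.bounded A hA
    obtain ⟨C₂, h₂⟩ := ν.bounded B hB
    refine ⟨C₁ * |C₂|, fun g M hg hM => ?_⟩
    have hM0 : 0 ≤ M := (norm_nonneg _).trans (hM 0)
    have hzero : ∀ x ∉ A, ν (translateFun x g) = 0 := fun x hx =>
      h _ (Set.disjoint_left.2 fun y hy hyK =>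
        hx ⟨(x + y, y), ⟨hg (tsupport_translateFun x g hy), hyK⟩, by simp⟩)
    rw [mul_assoc]
    refine h₁ (convFun ν hν g) (|C₂| * M) ?_ fun x => ?_
    · refine closure_minimal (fun x hx => ?_) hA.isClosed
      by_contra hxA
      exact hx (hzero x hxA)
    · by_cases hx : x ∈ A
      · refine (h₂ (translateFun x g) M (fun y hy => ?_) fun y => hM _).trans
          (mul_le_mul_of_nonneg_right (le_abs_self C₂) hM0)
        exact ⟨(x + y, x), ⟨hg (tsupport_translateFun x g hy), hx⟩, by simp⟩
      · rw [convFun_apply, hzero x hx, norm_zero]; positivity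

end ComplexRadonMeasure

theorem finite_int_preimage {K : Set ℝ} (hK : IsCompact K) : {n : ℤ | (n : ℝ) ∈ K}.Finite := by
  have := Int.isClosedEmbedding_coe_real.isCompact_preimage hK
  exact this.finite_of_discrete

theorem finite_support_comb (c : ℤ → ℂ) (g : C_c(ℝ, ℂ)) :
    (Function.support fun n : ℤ => c n * g n).Finite :=
  (finite_int_preimage g.hasCompactSupport.isCompact).subset fun _ hn =>
    subset_tsupport _ (right_ne_zero_of_mul hn)

/-- The weighted Dirac comb `∑ n, c n • δ_n`; on each test function the sum is finite. -/
def diracComb (c : ℤ → ℂ) : ComplexRadonMeasure where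
  toLinearMap :=
    { toFun := fun g => ∑ᶠ n : ℤ, c n * g n
      map_add' := fun g h => by
        rw [← finsum_add_distrib (finite_support_comb c g) (finite_support_comb c h)]
        exact finsum_congr fun n => by simp [mul_add]
      map_smul' := fun a g => by
        rw [RingHom.id_apply, smul_finsum' a (finite_support_comb c g)]
        exact finsum_congr fun n => by simp [mul_left_comm] }
  bounded := fun K hK => by
    refine ⟨∑ n ∈ (finite_int_preimage hK).toFinset, ‖c n‖, fun g M hg hM => ?_⟩
    change ‖∑ᶠ n : ℤ, c n * g n‖ ≤ _
    rw [finsum_eq_sum_of_support_subset (s := (finite_int_preimage hK).toFinset) _ (fun _ hn => by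
      simpa using hg (subset_tsupport _ (right_ne_zero_of_mul hn))), Finset.sum_mul]
    refine (norm_sum_le _ _).trans (Finset.sum_le_sum fun n _ => ?_)
    rw [norm_mul]
    exact mul_le_mul_of_nonneg_left (hM _) (norm_nonneg _)

/-- The restriction of the Dirac comb `∑ n, c n • δ_n` to the interval `[-N, N]`. -/
def restrictedComb (c : ℤ → ℂ) (N : ℕ) : ComplexRadonMeasure :=
  diracComb fun n => if |n| ≤ (N : ℤ) then c n else 0

theorem compactSupport_restrictedComb (c : ℤ → ℂ) (N : ℕ) :
    (restrictedComb c N).CompactSupport := by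
  refine ⟨Set.Icc (-(N : ℝ)) N, isCompact_Icc, fun g hg => ?_⟩
  change ∑ᶠ n : ℤ, (if |n| ≤ (N : ℤ) then c n else 0) * g n = 0
  refine finsum_eq_zero_of_forall_eq_zero fun n => ?_
  split_ifs with hn
  · have hmem : (n : ℝ) ∈ Set.Icc (-(N : ℝ)) N := by
      rw [abs_le] at hn
      exact ⟨by exact_mod_cast hn.1, by exact_mod_cast hn.2⟩
    have : g n = 0 := image_eq_zero_of_notMem_tsupport fun h => Set.disjoint_left.1 hg h hmem
    rw [this, mul_zero]
  · rw [zero_mul]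

/-- The measure `γ` is the autocorrelation of the Dirac comb `ω = ∑ n, c n • δ_n`: the vague limit
of `(ω_N * flip ω_N) / (2 N + 1)`, where `ω_N` is the restriction of `ω` to `[-N, N]`. -/
def IsAutocorrelation (c : ℤ → ℂ) (γ : ComplexRadonMeasure) : Prop :=
  ∀ g : C_c(ℝ, ℂ), Tendsto
    (fun N : ℕ => ((restrictedComb c N).conv (restrictedComb c N).flip
      (compactSupport_restrictedComb c N).flip) g / (2 * (N : ℂ) + 1))
    atTop (𝓝 (γ g))

/-- The positive measure `μ` is the Fourier transform of `γ`: both are tempered, and the Fourier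
transform of the tempered distribution `T` given by `γ` (the only one that agrees with `γ` on smooth
test functions of compact support) is the one given by `μ`.
Here `𝓕 φ k = ∫ exp (-2 π i k x) φ x dx`. -/
def IsFourierTransform (γ : ComplexRadonMeasure) (μ : Measure ℝ) : Prop :=
  ∃ (_ : μ.HasTemperateGrowth) (T : 𝓢'(ℝ, ℂ)),
    (∀ (φ : 𝓢(ℝ, ℂ)) (hφ : HasCompactSupport φ), T φ = γ ⟨⟨φ, φ.continuous⟩, hφ⟩) ∧
    𝓕 T = μ.toTemperedDistribution

/-- The measure `μ` is the diffraction measure of the Dirac comb `∑ n, c n • δ_n`: the Fourier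
transform of its autocorrelation. -/
def IsDiffractionMeasure (c : ℤ → ℂ) (μ : Measure ℝ) : Prop :=
  ∃ γ : ComplexRadonMeasure, IsAutocorrelation c γ ∧ IsFourierTransform γ μ

/-- A nonzero measure on the line without atoms that is singular with respect to Lebesgue
measure. -/
def IsPurelySingularContinuous (μ : Measure ℝ) : Prop :=
  μ ≠ 0 ∧ (∀ x : ℝ, μ {x} = 0) ∧ μ ⟂ₘ (volume : Measure ℝ)

/-- The generalised Thue–Morse substitution `a ↦ a^k (-a)^l` on the alphabet `{1, -1}`. -/
def gtmLetter (k l : ℕ) (a : ℤˣ) : List ℤˣ := List.replicate k a ++ List.replicate l (-a)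

/-- The substitution on finite words. -/
def gtmWord (k l : ℕ) (u : List ℤˣ) : List ℤˣ := u.flatMap (gtmLetter k l)

/-- The one-sided fixed point that starts with `1`: for `1 ≤ k` and `1 ≤ l` the `i`-fold
substitution of `1` is a prefix of it, of length `(k + l) ^ i > i`. -/
def gtmFixedPoint (k l : ℕ) (i : ℕ) : ℤˣ := ((gtmWord k l)^[i] [1]).getD i 1

/-- The two-sided sequence `… v₁ v₀ | v₀ v₁ …`, where `v` is the one-sided fixed point. -/
def gtmSequence (k l : ℕ) (n : ℤ) : ℤˣ :=
  if 0 ≤ n then gtmFixedPoint k l n.toNat else gtmFixedPoint k l (-n - 1).toNat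

/-- The discrete hull: the closure of the shift orbit in the product topology. -/
def gtmHull (k l : ℕ) : Set (ℤ → ℤˣ) :=
  closure (Set.range fun (i : ℤ) (n : ℤ) => gtmSequence k l (n + i))

/-- The letters of a two-sided sequence as complex weights `1` and `-1`. -/
def combWeights (w : ℤ → ℤˣ) (n : ℤ) : ℂ := ((w n : ℤ) : ℂ)

end

/-!
# The diffraction of the generalised Thue–Morse sequences is purely singular continuous

Write `m = k + l`, let `s a` be the sign of the `a`-th letter of the block `1 ^ k (-1) ^ l`, and let
`W x = |∑ a < m, s a exp (2 π i a x)| ^ 2 / m ^ 2`.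

The diffraction measure is the Riesz product `∏ n, m W (m ^ n x)`. It is characterised as a
`1`-periodic measure `Γ` of mass `1` per period with the self-similarity
`dΓ (x) = W (x) dΓ (m x)`, that is, `rieszStep k l Γ = Γ`. Such a measure exists: averages of the
partial Riesz products have a limit along an ultrafilter, which is a positive functional on test
functions, and the Riesz–Markov–Kakutani theorem turns it into a measure
(`exists_isPeriodicMeasure_rieszStep_eq`).

The self-similarity says that the Fourier coefficients `η j` of `Γ` satisfy the renormalisation
equations `m η j = ∑ a < m, s a * s ((j + a) % m) * η ((j + a) / m)` (`IsRenormalised`). The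
correlations of the fixed point of the substitution, averaged over long windows, satisfy the same
equations up to boundary terms, so they converge to `η j` uniformly in the position of the window
(`exists_norm_correlationDeviation_le`). A window of an element of the hull is a window of the
two-sided sequence, hence, up to finitely many terms, made of a window of the fixed point and a
reflected one. So every element of the hull has the autocorrelation `∑ j, η j δ_j`
(`isAutocorrelation_diracComb`).

The Fourier transform of `∑ j, η j δ_j` is `Γ` by Poisson summation
(`IsPeriodicMeasure.isFourierTransform`). It is unique because test functions of compact support are
dense in the Schwartz space (`IsFourierTransform.unique`).

The absolutely continuous part of `Γ` is periodic and self-similar too, by uniqueness of the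
Lebesgue decomposition, and its Fourier coefficients tend to `0` at infinity. A solution of the
renormalisation equations that decays at infinity vanishes at `0`
(`IsRenormalised.apply_zero_eq_zero`), so this part has no mass and `Γ` is singular. For atoms,
`Γ {x} = W x * W (m x) * Γ {m ^ 2 x}`, and `W x * W (m x)` is bounded by a constant smaller than
`1`, so iterating gives `Γ {x} = 0` (`measure_singleton_eq_zero_of_rieszStep_eq`).
-/

/-! ### The fixed point and its block structure -/

/-- The signs of the block `a ^ k (-a) ^ l` relative to the letter `a`. -/
def gtmSign (k r : ℕ) : ℤˣ := if r < k then 1 else -1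

theorem gtmSign_zero {k : ℕ} (hk : 1 ≤ k) : gtmSign k 0 = 1 := if_pos hk

theorem length_gtmLetter (k l : ℕ) (a : ℤˣ) : (gtmLetter k l a).length = k + l := by
  simp [gtmLetter]

theorem getElem?_gtmLetter {k l r : ℕ} (hr : r < k + l) (a : ℤˣ) :
    (gtmLetter k l a)[r]? = some (gtmSign k r * a) := by
  unfold gtmLetter gtmSign
  by_cases h : r < k
  · rw [List.getElem?_append_left (by simpa using h)]
    simp [h]
  · rw [List.getElem?_append_right (by simpa using h)]
    have : r - k < l := by omega
    simp [h, this]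

theorem getElem?_gtmWord {k l r : ℕ} (hr : r < k + l) (u : List ℤˣ) (n : ℕ) :
    (gtmWord k l u)[(k + l) * n + r]? = u[n]?.map (gtmSign k r * ·) := by
  induction u generalizing n with
  | nil => simp [gtmWord]
  | cons a u ih =>
    have hcons : gtmWord k l (a :: u) = gtmLetter k l a ++ gtmWord k l u := by simp [gtmWord]
    rw [hcons]
    cases n with
    | zero =>
      rw [List.getElem?_append_left (by rw [length_gtmLetter]; omega)]
      simpa using getElem?_gtmLetter hr a
    | succ n =>
      have hidx : (k + l) * (n + 1) + r = (k + l) + ((k + l) * n + r) := by ring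
      rw [List.getElem?_append_right (by rw [length_gtmLetter]; omega), length_gtmLetter, hidx,
        Nat.add_sub_cancel_left, ih]
      simp

theorem length_gtmWord (k l : ℕ) (u : List ℤˣ) :
    (gtmWord k l u).length = (k + l) * u.length := by
  simp [gtmWord, List.length_flatMap, length_gtmLetter, mul_comm]

theorem gtmWord_append (k l : ℕ) (u v : List ℤˣ) :
    gtmWord k l (u ++ v) = gtmWord k l u ++ gtmWord k l v := by
  simp [gtmWord]

theorem gtmWord_iterate_prefix {k l : ℕ} {u v : List ℤˣ} (h : u <+: v) (i : ℕ) :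
    (gtmWord k l)^[i] u <+: (gtmWord k l)^[i] v := by
  induction i with
  | zero => exact h
  | succ i ih =>
    obtain ⟨t, ht⟩ := ih
    rw [Function.iterate_succ_apply', Function.iterate_succ_apply', ← ht, gtmWord_append]
    exact List.prefix_append _ _

theorem length_gtmWord_iterate (k l i : ℕ) : ((gtmWord k l)^[i] [1]).length = (k + l) ^ i := by
  induction i with
  | zero => simp
  | succ i ih => rw [Function.iterate_succ_apply', length_gtmWord, ih]; ring

theorem gtmWord_iterate_prefix_succ {k : ℕ} (l : ℕ) (hk : 1 ≤ k) (i : ℕ) :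
    (gtmWord k l)^[i] [1] <+: (gtmWord k l)^[i + 1] [1] := by
  rw [Function.iterate_succ_apply]
  refine gtmWord_iterate_prefix ?_ i
  obtain ⟨k, rfl⟩ := Nat.exists_eq_add_of_le' hk
  exact ⟨List.replicate k 1 ++ List.replicate l (-1), by
    simp [gtmWord, gtmLetter, List.replicate_succ]⟩

theorem gtmWord_iterate_prefix_of_le {k : ℕ} (l : ℕ) (hk : 1 ≤ k) {i j : ℕ} (h : i ≤ j) :
    (gtmWord k l)^[i] [1] <+: (gtmWord k l)^[j] [1] := by
  induction j, h using Nat.le_induction with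
  | base => exact List.prefix_rfl
  | succ j _ ih => exact ih.trans (gtmWord_iterate_prefix_succ l hk j)

theorem getElem?_gtmWord_iterate {k l : ℕ} (hk : 1 ≤ k) (hl : 1 ≤ l) {i n : ℕ} (h : n ≤ i) :
    ((gtmWord k l)^[i] [1])[n]? = some (gtmFixedPoint k l n) := by
  have hn : n < ((gtmWord k l)^[n] [1]).length := by
    rw [length_gtmWord_iterate]; exact Nat.lt_pow_self (by omega)
  obtain ⟨t, ht⟩ := gtmWord_iterate_prefix_of_le l hk h
  rw [← ht, List.getElem?_append_left hn, List.getElem?_eq_getElem hn, gtmFixedPoint,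
    List.getD_eq_getElem _ _ hn]

/-- The fixed point equation of the substitution, read off letter by letter. -/
theorem gtmFixedPoint_mul_add {k l : ℕ} (hk : 1 ≤ k) (hl : 1 ≤ l) (n : ℕ) {r : ℕ}
    (hr : r < k + l) :
    gtmFixedPoint k l ((k + l) * n + r) = gtmSign k r * gtmFixedPoint k l n := by
  have hle : (k + l) * n + r ≤ (k + l) * n + r + 1 := by omega
  have hle' : n ≤ (k + l) * n + r := by nlinarith [Nat.zero_le (k * n), Nat.zero_le r]
  have h1 := getElem?_gtmWord_iterate hk hl hle
  rw [Function.iterate_succ_apply', getElem?_gtmWord hr, getElem?_gtmWord_iterate hk hl hle'] at h1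
  simpa using h1.symm

/-! ### Uniform correlations of the fixed point -/

/-- The renormalisation equations for the autocorrelation coefficients of the generalised
Thue–Morse sequence: with `m = k + l`, shifting by `j` moves the entry at position `a` of a block to
the position `(j + a) % m` of the block that lies `(j + a) / m` blocks further on. -/
def IsRenormalised (k l : ℕ) (η : ℤ → ℂ) : Prop :=
  ∀ j : ℤ, ((k + l : ℕ) : ℂ) * η j = ∑ a ∈ Finset.range (k + l),
    (((gtmSign k a * gtmSign k ((j + a) % (k + l : ℕ)).toNat : ℤˣ) : ℤ) : ℂ) *
      η ((j + a) / (k + l : ℕ))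

theorem norm_units_cast (u : ℤˣ) : ‖((u : ℤ) : ℂ)‖ = 1 := by
  rcases Int.units_eq_one_or u with rfl | rfl <;> simp

/-- The deviation of the correlations of `v` at distance `j`, summed over the window
`[a, a + L)`, from the expected value. -/
def correlationDeviation (v : ℕ → ℤˣ) (η : ℤ → ℂ) (j a L : ℕ) : ℂ :=
  ∑ i ∈ Finset.range L, ((((v (a + i) * v (a + i + j) : ℤˣ) : ℤ) : ℂ) - η j)

theorem correlationDeviation_add (v : ℕ → ℤˣ) (η : ℤ → ℂ) (j a L L' : ℕ) :
    correlationDeviation v η j a (L + L') =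
      correlationDeviation v η j a L + correlationDeviation v η j (a + L) L' := by
  simp only [correlationDeviation, Finset.sum_range_add, add_assoc]

theorem norm_correlationDeviation_le (v : ℕ → ℤˣ) (η : ℤ → ℂ) (j a L : ℕ) :
    ‖correlationDeviation v η j a L‖ ≤ L * (1 + ‖η j‖) := by
  refine (norm_sum_le _ _).trans ((Finset.sum_le_card_nsmul _ _ (1 + ‖η j‖) fun i _ => ?_).trans ?_)
  · exact (norm_sub_le _ _).trans (by rw [norm_units_cast])
  · rw [Finset.card_range, nsmul_eq_mul]

/-- Summed over whole blocks, the deviation at distance `j` is a combination of deviations at the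
distances `(a + j) / m`. -/
theorem correlationDeviation_mul {k l : ℕ} {v : ℕ → ℤˣ} {η : ℤ → ℂ} (hm : 0 < k + l)
    (hv : ∀ n r, r < k + l → v ((k + l) * n + r) = gtmSign k r * v n)
    (hη : IsRenormalised k l η) (j a L : ℕ) :
    correlationDeviation v η j ((k + l) * a) ((k + l) * L) =
      ∑ b ∈ Finset.range (k + l), (((gtmSign k b * gtmSign k ((j + b) % (k + l)) : ℤˣ) : ℤ) : ℂ) *
        correlationDeviation v η ((j + b) / (k + l)) a L := by
  set m := k + l
  induction L with
  | zero => simp [correlationDeviation]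
  | succ L ih =>
    rw [mul_add, mul_one, correlationDeviation_add, ih, ← mul_add]
    simp only [correlationDeviation_add, mul_add]
    rw [Finset.sum_add_distrib]
    congr 1
    have hη' : (m : ℂ) * η j = ∑ b ∈ Finset.range m,
        (((gtmSign k b * gtmSign k ((j + b) % m) : ℤˣ) : ℤ) : ℂ) * η (((j + b) / m : ℕ)) := by
      rw [hη j]
      refine Finset.sum_congr rfl fun b _ => ?_
      have h1 : (((j : ℤ) + b) % (m : ℕ)).toNat = (j + b) % m := by
        rw [← Int.natCast_add, ← Int.natCast_mod, Int.toNat_natCast]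
      rw [h1]
      congr 2
    simp only [correlationDeviation, Finset.sum_sub_distrib, Finset.sum_const, Finset.card_range,
      nsmul_eq_mul, hη', Finset.sum_range_one, mul_sub, Nat.cast_one, one_mul, add_zero]
    congr 1
    refine Finset.sum_congr rfl fun b hb => ?_
    have hb : b < m := Finset.mem_range.1 hb
    have hidx : m * a + m * L + b + j = m * (a + L + (j + b) / m) + (j + b) % m := by
      have := Nat.div_add_mod (j + b) m
      rw [mul_add, mul_add]; omega
    rw [← mul_add, hv _ _ hb, mul_add, hidx, hv _ _ (Nat.mod_lt _ hm)]
    push_cast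
    ring

/-- The deviation over an arbitrary window and over the blocks it consists of differ by a bounded
amount. -/
theorem norm_correlationDeviation_le_blocks {m : ℕ} (hm : 0 < m) (v : ℕ → ℤˣ) (η : ℤ → ℂ)
    (j a L : ℕ) :
    ‖correlationDeviation v η j a L‖ ≤
      ‖correlationDeviation v η j (m * (a / m)) (m * (L / m))‖ + 3 * m * (1 + ‖η j‖) := by
  have ha := Nat.div_add_mod a m
  have hL := Nat.div_add_mod L m
  have ham := Nat.mod_lt a hm
  have hLm := Nat.mod_lt L hm
  have h1 := correlationDeviation_add v η j (m * (a / m)) (a % m) L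
  have h2 := correlationDeviation_add v η j (m * (a / m)) (m * (L / m)) (L % m + a % m)
  have hsum : a % m + L = m * (L / m) + (L % m + a % m) := by omega
  rw [ha, hsum, h2] at h1
  have h3 := norm_correlationDeviation_le v η j (m * (a / m)) (a % m)
  have h4 := norm_correlationDeviation_le v η j (m * (a / m) + m * (L / m)) (L % m + a % m)
  have h5 : correlationDeviation v η j a L =
      correlationDeviation v η j (m * (a / m)) (m * (L / m)) +
      correlationDeviation v η j (m * (a / m) + m * (L / m)) (L % m + a % m) -
      correlationDeviation v η j (m * (a / m)) (a % m) := by rw [h1]; ring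
  rw [h5]
  have h6 : ((a % m : ℕ) : ℝ) ≤ m := by exact_mod_cast ham.le
  have h7 : ((L % m + a % m : ℕ) : ℝ) ≤ 2 * m := by exact_mod_cast (by omega)
  have h8 : 0 ≤ 1 + ‖η j‖ := by positivity
  refine (norm_sub_le _ _).trans ?_
  refine (add_le_add (norm_add_le _ _) h3).trans ?_
  nlinarith

/-- The correlations of the fixed point at distance `j` average to `η j`, uniformly in the position
of the window. -/
theorem exists_norm_correlationDeviation_le {k l : ℕ} (hk : 1 ≤ k) (hl : 1 ≤ l) {v : ℕ → ℤˣ}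
    {η : ℤ → ℂ} (hv : ∀ n r, r < k + l → v ((k + l) * n + r) = gtmSign k r * v n)
    (hη : IsRenormalised k l η) (h0 : η 0 = 1) (j : ℕ) {ε : ℝ} (hε : 0 < ε) :
    ∃ C : ℝ, ∀ a L : ℕ, ‖correlationDeviation v η j a L‖ ≤ ε * L + C := by
  have hm : 2 ≤ k + l := by omega
  have hm0 : 0 < k + l := by omega
  have hblock : ∀ j a L : ℕ, ‖correlationDeviation v η j ((k + l) * a) ((k + l) * L)‖ ≤
      ∑ b ∈ Finset.range (k + l), ‖correlationDeviation v η ((j + b) / (k + l)) a L‖ := by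
    intro j a L
    rw [correlationDeviation_mul hm0 hv hη]
    refine (norm_sum_le _ _).trans (Finset.sum_le_sum fun b _ => ?_)
    rw [norm_mul, norm_units_cast, one_mul]
  have hzero : ∀ a L : ℕ, correlationDeviation v η 0 a L = 0 := by
    intro a L
    refine Finset.sum_eq_zero fun i _ => ?_
    rcases Int.units_eq_one_or (v (a + i)) with h | h <;> simp [h, h0]
  set m := k + l with hmdef
  induction j using Nat.strong_induction_on generalizing ε with
  | _ j ih =>
  rcases Nat.lt_or_ge 1 j with hj | hj
  · -- All distances `(j + b) / m` are smaller than `j`.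
    have hlt : ∀ b ∈ Finset.range m, (j + b) / m < j := by
      intro b hb
      rw [Finset.mem_range] at hb
      rw [Nat.div_lt_iff_lt_mul hm0]
      nlinarith
    choose! C hC using fun b (hb : b ∈ Finset.range m) => ih _ (hlt b hb) hε
    refine ⟨∑ b ∈ Finset.range m, C b + 3 * m * (1 + ‖η j‖), fun a L => ?_⟩
    refine (norm_correlationDeviation_le_blocks hm0 v η j a L).trans ?_
    rw [← add_assoc]
    gcongr
    refine (hblock j _ _).trans ((Finset.sum_le_sum fun b hb => hC b hb _ _).trans ?_)
    rw [Finset.sum_add_distrib, Finset.sum_const, Finset.card_range, nsmul_eq_mul]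
    have : (m : ℝ) * ((L / m : ℕ) : ℝ) ≤ L := by exact_mod_cast Nat.mul_div_le L m
    nlinarith
  · rcases Nat.eq_zero_or_pos j with rfl | hj0
    · exact ⟨0, fun a L => by rw [hzero]; simp; positivity⟩
    obtain rfl : j = 1 := by omega
    -- Only the last position of a block is carried into the next block, so the deviation over
    -- a window is bounded by that over a window `m` times shorter, up to the constant `K`.
    set K : ℝ := 3 * m * (1 + ‖η (1 : ℕ)‖) with hK
    have hK0 : 0 ≤ K := by positivity
    have hstep : ∀ a L : ℕ, ‖correlationDeviation v η 1 a L‖ ≤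
        ‖correlationDeviation v η 1 (a / m) (L / m)‖ + K := by
      intro a L
      refine (norm_correlationDeviation_le_blocks hm0 v η 1 a L).trans ?_
      gcongr
      refine (hblock 1 _ _).trans ?_
      obtain ⟨p, hp⟩ : ∃ p, m = p + 1 := ⟨m - 1, by omega⟩
      rw [hp, Finset.sum_range_succ, Finset.sum_eq_zero, zero_add]
      · rw [show (1 + p) / (p + 1) = 1 by rw [add_comm, Nat.div_self (by omega)]]
      · intro b hb
        rw [Finset.mem_range] at hb
        rw [Nat.div_eq_of_lt (by omega), hzero, norm_zero]
    set B : ℝ := 1 + ‖η (1 : ℕ)‖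
    have hB : 0 ≤ B := by positivity
    refine ⟨2 * K / ε * B, fun a L => ?_⟩
    induction L using Nat.strong_induction_on generalizing a with
    | _ L ihL =>
    by_cases hLK : (L : ℝ) ≤ 2 * K / ε
    · refine (norm_correlationDeviation_le v η 1 a L).trans ?_
      have : (L : ℝ) * B ≤ 2 * K / ε * B := by gcongr
      exact this.trans (le_add_of_nonneg_left (by positivity))
    · push Not at hLK
      have hL0 : 0 < L := by
        have : (0 : ℝ) < L := lt_of_le_of_lt (by positivity) hLK
        exact_mod_cast this
      refine (hstep a L).trans ?_
      have h1 := ihL (L / m) (Nat.div_lt_self hL0 hm) (a / m)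
      have h2 : ((L / m : ℕ) : ℝ) ≤ L / 2 := by
        rw [le_div_iff₀ two_pos]
        have : (L / m) * 2 ≤ L := (Nat.mul_le_mul_left _ hm).trans (Nat.div_mul_le_self L m)
        exact_mod_cast this
      have h3 : 2 * K < ε * L := by rwa [div_lt_iff₀' hε] at hLK
      have h4 : ε * ((L / m : ℕ) : ℝ) ≤ ε * (L / 2) := by gcongr
      linarith

/-! ### Correlations of the elements of the hull -/

/-- The correlations of the two-sided sequence average to `η j` uniformly over all windows: apart
from at most `j` terms, a window splits into a window of the fixed point and a window of its
reflection. -/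
theorem exists_norm_sum_gtmSequence_le {k l : ℕ} (hk : 1 ≤ k) (hl : 1 ≤ l) {η : ℤ → ℂ}
    (hη : IsRenormalised k l η) (h0 : η 0 = 1) (j : ℕ) {ε : ℝ} (hε : 0 < ε) :
    ∃ C : ℝ, ∀ (a : ℤ) (L : ℕ), ‖∑ i ∈ Finset.range L,
      ((((gtmSequence k l (a + i) * gtmSequence k l (a + i + j) : ℤˣ) : ℤ) : ℂ) - η j)‖
        ≤ ε * L + C := by
  obtain ⟨C, hC⟩ := exists_norm_correlationDeviation_le hk hl
    (fun n r hr => gtmFixedPoint_mul_add hk hl n hr) hη h0 j hε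
  have hC0 : 0 ≤ C := by simpa [correlationDeviation] using hC 0 0
  set f : ℤ → ℂ := fun n =>
    (((gtmSequence k l n * gtmSequence k l (n + j) : ℤˣ) : ℤ) : ℂ) - η j with hf
  have hpos : ∀ (a : ℤ) (L : ℕ), (L ≠ 0 → 0 ≤ a) →
      ‖∑ i ∈ Finset.range L, f (a + i)‖ ≤ ε * L + C := by
    intro a L ha
    rcases eq_or_ne L 0 with rfl | hL
    · simpa using hC0
    refine le_of_eq_of_le ?_ (hC a.toNat L)
    congr 1
    refine Finset.sum_congr rfl fun i _ => ?_
    have ha := ha hL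
    have h1 : gtmSequence k l (a + i) = gtmFixedPoint k l (a.toNat + i) := by
      rw [gtmSequence, if_pos (by omega)]; congr 1; omega
    have h2 : gtmSequence k l (a + i + j) = gtmFixedPoint k l (a.toNat + i + j) := by
      rw [gtmSequence, if_pos (by omega)]; congr 1; omega
    rw [hf]; simp only [h1, h2]
  have hneg : ∀ (a : ℤ) (L : ℕ), (L ≠ 0 → a + L ≤ -j) →
      ‖∑ i ∈ Finset.range L, f (a + i)‖ ≤ ε * L + C := by
    intro a L ha
    rcases eq_or_ne L 0 with rfl | hL
    · simpa using hC0
    refine le_of_eq_of_le ?_ (hC (-(a + L) - j).toNat L)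
    rw [← Finset.sum_range_reflect]
    congr 1
    refine Finset.sum_congr rfl fun i hi => ?_
    have hi := Finset.mem_range.1 hi
    have ha := ha hL
    have h1 : gtmSequence k l (a + (L - 1 - i : ℕ)) =
        gtmFixedPoint k l ((-(a + L) - j).toNat + i + j) := by
      rw [gtmSequence, if_neg (by omega)]; congr 1; omega
    have h2 : gtmSequence k l (a + (L - 1 - i : ℕ) + j) =
        gtmFixedPoint k l ((-(a + L) - j).toNat + i) := by
      rw [gtmSequence, if_neg (by omega)]; congr 1; omega
    rw [hf]; simp only [h1, h2, mul_comm]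
  refine ⟨2 * C + j * (1 + ‖η j‖), fun a L => ?_⟩
  obtain ⟨L₁, L₂, L₃, rfl, h1, h2, h3⟩ : ∃ L₁ L₂ L₃ : ℕ, L = L₁ + L₂ + L₃ ∧
      (L₁ ≠ 0 → a + L₁ ≤ -j) ∧ L₂ ≤ j ∧ (L₃ ≠ 0 → 0 ≤ a + L₁ + L₂) := by
    set L₁ := min L (-j - a).toNat
    set L₂ := min (L - L₁) (-(a + L₁)).toNat
    exact ⟨L₁, L₂, L - L₁ - L₂, by omega, by omega, by omega, by omega⟩
  change ‖∑ i ∈ Finset.range (L₁ + L₂ + L₃), f (a + i)‖ ≤ _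
  rw [Finset.sum_range_add, Finset.sum_range_add]
  have hmid : ‖∑ i ∈ Finset.range L₂, f (a + (L₁ + i : ℕ))‖ ≤ j * (1 + ‖η j‖) := by
    refine (norm_sum_le _ _).trans
      ((Finset.sum_le_card_nsmul _ _ (1 + ‖η j‖) fun i _ => ?_).trans ?_)
    · exact (norm_sub_le _ _).trans (by rw [norm_units_cast])
    · rw [Finset.card_range, nsmul_eq_mul]
      gcongr
  have hlast := hpos (a + L₁ + L₂) L₃ h3
  have hfirst := hneg a L₁ h1
  have hidx : ∀ i : ℕ, a + L₁ + L₂ + (i : ℤ) = a + ((L₁ + L₂ + i : ℕ) : ℤ) := by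
    intro i; push_cast; ring
  simp only [hidx] at hlast
  refine (norm_add₃_le).trans ?_
  rw [Nat.cast_add, Nat.cast_add]
  nlinarith [mul_nonneg hε.le (Nat.cast_nonneg (α := ℝ) L₂)]

/-- Every window of an element of the hull is a window of the two-sided sequence. -/
theorem exists_forall_eq_gtmSequence {k l : ℕ} {w : ℤ → ℤˣ} (hw : w ∈ gtmHull k l)
    (s : Finset ℤ) : ∃ i : ℤ, ∀ n ∈ s, w n = gtmSequence k l (n + i) := by
  have hopen : IsOpen ((s : Set ℤ).pi fun n => ({w n} : Set ℤˣ)) :=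
    isOpen_set_pi s.finite_toSet fun n _ => isOpen_discrete _
  obtain ⟨_, hx, i, rfl⟩ := mem_closure_iff.1 hw _ hopen fun n _ => rfl
  exact ⟨i, fun n hn => (hx n hn).symm⟩

/-- The sum of `w (p + j) * w p` over all `p` with `|p| ≤ N` and `|p + j| ≤ N`. -/
noncomputable def windowCorrelation (w : ℤ → ℤˣ) (N : ℕ) (j : ℤ) : ℂ :=
  ∑ p ∈ Finset.Icc (-(N : ℤ)) N,
    if |p + j| ≤ (N : ℤ) then (((w (p + j) * w p : ℤˣ) : ℤ) : ℂ) else 0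

theorem windowCorrelation_neg (w : ℤ → ℤˣ) (N : ℕ) (j : ℤ) :
    windowCorrelation w N (-j) = windowCorrelation w N j := by
  unfold windowCorrelation
  rw [← Finset.sum_filter, ← Finset.sum_filter]
  refine Finset.sum_bij (fun p _ => p - j) ?_ (by intros; omega) ?_ ?_
  · intro p hp
    simp only [Finset.mem_filter, Finset.mem_Icc, abs_le] at hp ⊢
    omega
  · intro p hp
    refine ⟨p + j, ?_, by ring⟩
    simp only [Finset.mem_filter, Finset.mem_Icc, abs_le] at hp ⊢
    omega
  · intro p _
    rw [sub_add_cancel, ← sub_eq_add_neg, mul_comm]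

theorem windowCorrelation_natCast (w : ℤ → ℤˣ) (N j : ℕ) :
    windowCorrelation w N j = ∑ i ∈ Finset.range (2 * N + 1 - j),
      (((w (-N + i) * w (-N + i + j) : ℤˣ) : ℤ) : ℂ) := by
  unfold windowCorrelation
  rw [← Finset.sum_filter]
  refine Finset.sum_bij (fun p _ => (p + N).toNat) ?_ ?_ ?_ ?_
  · intro p hp
    simp only [Finset.mem_filter, Finset.mem_Icc, abs_le, Finset.mem_range] at hp ⊢
    omega
  · intro p hp q hq h
    simp only [Finset.mem_filter, Finset.mem_Icc, abs_le] at hp hq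
    omega
  · intro i hi
    refine ⟨-N + i, ?_, by omega⟩
    simp only [Finset.mem_filter, Finset.mem_Icc, abs_le, Finset.mem_range] at hi ⊢
    omega
  · intro p hp
    simp only [Finset.mem_filter, Finset.mem_Icc, abs_le] at hp
    rw [show -(N : ℤ) + ((p + N).toNat : ℤ) = p by omega, mul_comm]

theorem tendsto_windowCorrelation {k l : ℕ} (hk : 1 ≤ k) (hl : 1 ≤ l) {η : ℤ → ℂ}
    (hη : IsRenormalised k l η) (h0 : η 0 = 1) (hneg : ∀ j, η (-j) = η j) {w : ℤ → ℤˣ}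
    (hw : w ∈ gtmHull k l) (j : ℤ) :
    Tendsto (fun N : ℕ => windowCorrelation w N j / (2 * (N : ℂ) + 1)) atTop (𝓝 (η j)) := by
  wlog hj : 0 ≤ j generalizing j
  · simpa only [windowCorrelation_neg, hneg] using this (-j) (by omega)
  lift j to ℕ using hj
  refine Metric.tendsto_atTop.2 fun ε hε => ?_
  obtain ⟨C, hC⟩ := exists_norm_sum_gtmSequence_le hk hl hη h0 j (half_pos hε)
  set D : ℝ := C + j * ‖η j‖
  obtain ⟨N₀, hN₀⟩ := exists_nat_gt (D / ε + j)
  refine ⟨N₀, fun N hN => ?_⟩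
  have hNR : (N₀ : ℝ) ≤ N := by exact_mod_cast hN
  have hjN : j ≤ 2 * N + 1 := by
    by_cases hD : 0 ≤ D
    · have h1 : 0 ≤ D / ε := by positivity
      have h2 : (j : ℝ) < N := by linarith
      have h3 : j < N := by exact_mod_cast h2
      omega
    · have := hC 0 0
      have : 0 ≤ C := by simpa using this
      exact absurd (by positivity) hD
  have hDN : D < ε / 2 * (2 * N + 1) := by
    have h1 : D / ε < N := by
      have : (0 : ℝ) ≤ j := Nat.cast_nonneg j
      linarith
    rw [div_lt_iff₀ hε] at h1
    linarith
  obtain ⟨i, hi⟩ := exists_forall_eq_gtmSequence hw (Finset.Icc (-(N : ℤ)) N)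
  have hsum : windowCorrelation w N j - (2 * (N : ℂ) + 1) * η j =
      ∑ p ∈ Finset.range (2 * N + 1 - j),
        ((((gtmSequence k l (-N + i + p) * gtmSequence k l (-N + i + p + j) : ℤˣ) : ℤ) : ℂ) - η j)
        - j * η j := by
    rw [windowCorrelation_natCast, Finset.sum_sub_distrib, Finset.sum_const, Finset.card_range,
      nsmul_eq_mul, Nat.cast_sub hjN]
    have : ∀ p ∈ Finset.range (2 * N + 1 - j),
        (((w (-N + p) * w (-N + p + j) : ℤˣ) : ℤ) : ℂ) =
        (((gtmSequence k l (-N + i + p) * gtmSequence k l (-N + i + p + j) : ℤˣ) : ℤ) : ℂ) := by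
      intro p hp
      rw [Finset.mem_range] at hp
      rw [hi _ (by rw [Finset.mem_Icc]; omega), hi _ (by rw [Finset.mem_Icc]; omega)]
      rw [show -(N : ℤ) + p + i = -N + i + p by ring,
        show -(N : ℤ) + p + j + i = -N + i + p + j by ring]
    rw [Finset.sum_congr rfl this]
    push_cast
    ring
  have hne : (2 * (N : ℂ) + 1) ≠ 0 := by exact_mod_cast (Nat.succ_ne_zero (2 * N))
  have hnorm : ‖2 * (N : ℂ) + 1‖ = 2 * N + 1 := by
    have : (2 * (N : ℂ) + 1) = ((2 * N + 1 : ℕ) : ℂ) := by push_cast; ring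
    rw [this, Complex.norm_natCast]; push_cast; ring
  rw [dist_eq_norm, div_sub' hne, norm_div, hnorm, hsum, div_lt_iff₀ (by positivity)]
  refine (norm_sub_le _ _).trans_lt ((add_le_add_left (hC _ _) _).trans_lt ?_)
  rw [norm_mul, Complex.norm_natCast, Nat.cast_sub hjN]
  push_cast
  have : 0 ≤ ε / 2 * (j : ℝ) := by positivity
  linarith

/-! ### The autocorrelation -/

theorem restrictedComb_apply (c : ℤ → ℂ) (N : ℕ) (g : C_c(ℝ, ℂ)) :
    restrictedComb c N g = ∑ n ∈ Finset.Icc (-(N : ℤ)) N, c n * g n := by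
  change ∑ᶠ n : ℤ, (if |n| ≤ (N : ℤ) then c n else 0) * g n = _
  rw [finsum_eq_sum_of_support_subset (s := Finset.Icc (-(N : ℤ)) N)]
  · refine Finset.sum_congr rfl fun n hn => ?_
    rw [if_pos (by rw [abs_le]; exact Finset.mem_Icc.1 hn)]
  · intro n hn
    by_contra h
    refine hn ?_
    rw [Finset.mem_coe, Finset.mem_Icc, ← abs_le] at h
    simp only [if_neg h, zero_mul]

theorem diracComb_apply_eq_sum (c : ℤ → ℂ) (g : C_c(ℝ, ℂ)) {s : Finset ℤ}
    (hs : ∀ n : ℤ, g n ≠ 0 → n ∈ s) : diracComb c g = ∑ n ∈ s, c n * g n :=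
  finsum_eq_sum_of_support_subset _ fun n hn => hs n (right_ne_zero_of_mul hn)

theorem conv_flip_restrictedComb_apply (w : ℤ → ℤˣ) (N : ℕ) (g : C_c(ℝ, ℂ)) {s : Finset ℤ}
    (hs : ∀ n : ℤ, g n ≠ 0 → n ∈ s) :
    ((restrictedComb (combWeights w) N).conv (restrictedComb (combWeights w) N).flip
      (compactSupport_restrictedComb (combWeights w) N).flip) g =
    ∑ j ∈ s, windowCorrelation w N j * g j := by
  have hflip : ∀ g : C_c(ℝ, ℂ), (restrictedComb (combWeights w) N).flip g =
      ∑ p ∈ Finset.Icc (-(N : ℤ)) N, combWeights w p * g (-p) := by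
    intro g
    change starRingEnd ℂ (restrictedComb (combWeights w) N (ComplexRadonMeasure.flipFun g)) = _
    rw [restrictedComb_apply, map_sum]
    refine Finset.sum_congr rfl fun p _ => ?_
    simp [combWeights]
  change restrictedComb (combWeights w) N (ComplexRadonMeasure.convFun _ _ g) = _
  rw [restrictedComb_apply]
  simp only [ComplexRadonMeasure.convFun_apply, hflip, ComplexRadonMeasure.translateFun_apply,
    windowCorrelation, Finset.mul_sum, Finset.sum_mul]
  rw [Finset.sum_comm, Finset.sum_comm (s := s)]
  refine Finset.sum_congr rfl fun p _ => ?_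
  rw [← Finset.sum_filter_of_ne (s := s) (p := fun j => |p + j| ≤ (N : ℤ))
    (fun j _ hj => by by_contra h; simp [h] at hj)]
  refine Finset.sum_bij_ne_zero (fun n _ _ => n - p) ?_ (by intros; omega) ?_ ?_
  · intro n hn h
    rw [Finset.mem_filter]
    refine ⟨hs _ fun h0 => h ?_, ?_⟩
    · have : (n : ℝ) + -(p : ℝ) = ((n - p : ℤ) : ℝ) := by push_cast; ring
      rw [this, h0]; simp
    · rw [add_sub_cancel, abs_le]; exact Finset.mem_Icc.1 hn
  · intro j hj h
    rw [Finset.mem_filter] at hj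
    refine ⟨p + j, by rw [Finset.mem_Icc, ← abs_le]; exact hj.2, ?_, by ring⟩
    have : ((p + j : ℤ) : ℝ) + -(p : ℝ) = (j : ℝ) := by push_cast; ring
    rw [this]
    rw [if_pos hj.2] at h
    simpa [combWeights, mul_assoc] using h
  · intro n hn _
    have h1 : (n : ℝ) + -(p : ℝ) = ((n - p : ℤ) : ℝ) := by push_cast; ring
    have h2 : |p + (n - p)| ≤ (N : ℤ) := by
      rw [add_sub_cancel, abs_le]; exact Finset.mem_Icc.1 hn
    rw [if_pos h2, h1, add_sub_cancel]
    simp [combWeights, mul_assoc]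

theorem isAutocorrelation_diracComb {k l : ℕ} (hk : 1 ≤ k) (hl : 1 ≤ l) {η : ℤ → ℂ}
    (hη : IsRenormalised k l η) (h0 : η 0 = 1) (hneg : ∀ j, η (-j) = η j) {w : ℤ → ℤˣ}
    (hw : w ∈ gtmHull k l) : IsAutocorrelation (combWeights w) (diracComb η) := by
  intro g
  have hs : ∀ n : ℤ, g n ≠ 0 →
      n ∈ (finite_int_preimage g.hasCompactSupport.isCompact).toFinset := fun n hn => by
    simpa using subset_tsupport _ hn
  simp only [conv_flip_restrictedComb_apply w _ g hs, diracComb_apply_eq_sum η g hs,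
    Finset.sum_div]
  refine tendsto_finsetSum _ fun j _ => ?_
  simpa only [mul_div_right_comm] using
    (tendsto_windowCorrelation hk hl hη h0 hneg hw j).mul_const (g j)

/-! ### The trigonometric weight -/

theorem fourierChar_intCast (n : ℤ) : (𝐞 (n : ℝ) : ℂ) = 1 := by
  rw [Real.fourierChar_apply, Complex.exp_eq_one_iff]
  exact ⟨n, by push_cast; ring⟩

theorem fourierChar_eq_one_iff {x : ℝ} : (𝐞 x : ℂ) = 1 ↔ ∃ n : ℤ, x = n := by
  refine ⟨fun h => ?_, fun ⟨n, hn⟩ => by rw [hn, fourierChar_intCast]⟩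
  rw [Real.fourierChar_apply, Complex.exp_eq_one_iff] at h
  obtain ⟨n, hn⟩ := h
  refine ⟨n, ?_⟩
  have h2 : (2 * (Real.pi : ℂ) * Complex.I) ≠ 0 := Complex.two_pi_I_ne_zero
  have h3 : (x : ℂ) = n := mul_right_cancel₀ h2 (by rw [← hn]; push_cast; ring)
  exact_mod_cast h3

theorem coe_fourierChar_add (x y : ℝ) : (𝐞 (x + y) : ℂ) = 𝐞 x * 𝐞 y := by
  rw [AddChar.map_add_eq_mul, Circle.coe_mul]

theorem coe_fourierChar_nat_mul (n : ℕ) (x : ℝ) : (𝐞 (n * x) : ℂ) = (𝐞 x : ℂ) ^ n := by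
  rw [← nsmul_eq_mul, AddChar.map_nsmul_eq_pow, Circle.coe_pow]

theorem coe_fourierChar_neg (x : ℝ) : (𝐞 (-x) : ℂ) = starRingEnd ℂ (𝐞 x : ℂ) := by
  rw [AddChar.map_neg_eq_inv, Circle.coe_inv_eq_conj]

theorem continuous_coe_fourierChar : Continuous fun x : ℝ => (𝐞 x : ℂ) :=
  continuous_subtype_val.comp Real.continuous_fourierChar

/-- Summing a character of frequency `d / m` over the `m` shifts by integers. -/
theorem sum_fourierChar_shift {m : ℕ} (hm : 0 < m) (d : ℤ) (y : ℝ) :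
    ∑ i ∈ Finset.range m, (𝐞 (d * ((y + i) / m)) : ℂ) =
      if (m : ℤ) ∣ d then (m : ℂ) * 𝐞 ((d / (m : ℤ) : ℤ) * y) else 0 := by
  have hm0 : (m : ℝ) ≠ 0 := by positivity
  have hterm : ∀ i : ℕ, (𝐞 (d * ((y + i) / m)) : ℂ) = 𝐞 (d * (y / m)) * (𝐞 (d / m : ℝ) : ℂ) ^ i := by
    intro i
    rw [← coe_fourierChar_nat_mul, ← coe_fourierChar_add]
    congr 3
    ring
  simp only [hterm, ← Finset.mul_sum]
  split_ifs with h
  · obtain ⟨q, rfl⟩ := h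
    have h1 : (𝐞 (((m * q : ℤ) : ℝ) / m) : ℂ) = 1 :=
      fourierChar_eq_one_iff.2 ⟨q, by push_cast; field_simp⟩
    have h2 : ((m * q : ℤ) : ℝ) * (y / m) = q * y := by push_cast; field_simp
    rw [h1, h2, Int.mul_ediv_cancel_left _ (by omega)]
    simp [mul_comm]
  · have hne : (𝐞 ((d : ℝ) / m) : ℂ) ≠ 1 := by
      rw [Ne, fourierChar_eq_one_iff]
      rintro ⟨n, hn⟩
      rw [div_eq_iff hm0] at hn
      exact h ⟨n, by rw [mul_comm]; exact_mod_cast hn⟩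
    have hpow : (𝐞 ((d : ℝ) / m) : ℂ) ^ m = 1 := by
      rw [← coe_fourierChar_nat_mul, mul_div_cancel₀ _ hm0, fourierChar_intCast]
    rw [geom_sum_eq hne, hpow, sub_self, zero_div, mul_zero]

/-- The trigonometric polynomial of the block `1 ^ k (-1) ^ l`, divided by the block length. -/
noncomputable def gtmPolynomial (k l : ℕ) (x : ℝ) : ℂ :=
  (∑ a ∈ Finset.range (k + l), ((gtmSign k a : ℤ) : ℂ) * 𝐞 (a * x)) / (k + l : ℕ)

/-- The squared modulus of `gtmPolynomial`, the factor of the Riesz product. -/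
noncomputable def gtmWeight (k l : ℕ) (x : ℝ) : ℝ := ‖gtmPolynomial k l x‖ ^ 2

theorem continuous_gtmPolynomial (k l : ℕ) : Continuous (gtmPolynomial k l) := by
  unfold gtmPolynomial
  refine Continuous.div_const (continuous_finsetSum _ fun a _ => continuous_const.mul ?_) _
  exact continuous_coe_fourierChar.comp (continuous_const.mul continuous_id)

theorem continuous_gtmWeight (k l : ℕ) : Continuous (gtmWeight k l) :=
  (continuous_gtmPolynomial k l).norm.pow 2

theorem gtmWeight_nonneg (k l : ℕ) (x : ℝ) : 0 ≤ gtmWeight k l x := by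
  unfold gtmWeight; positivity

theorem gtmPolynomial_add_one (k l : ℕ) (x : ℝ) :
    gtmPolynomial k l (x + 1) = gtmPolynomial k l x := by
  unfold gtmPolynomial
  congr 1
  refine Finset.sum_congr rfl fun a _ => ?_
  have : (𝐞 ((a : ℝ) * 1) : ℂ) = 1 := fourierChar_eq_one_iff.2 ⟨a, by simp⟩
  rw [mul_add, coe_fourierChar_add, this, mul_one]

theorem gtmWeight_add_one (k l : ℕ) (x : ℝ) : gtmWeight k l (x + 1) = gtmWeight k l x := by
  rw [gtmWeight, gtmPolynomial_add_one, gtmWeight]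

theorem norm_gtmPolynomial_le_one (k l : ℕ) (x : ℝ) : ‖gtmPolynomial k l x‖ ≤ 1 := by
  rw [gtmPolynomial, norm_div, Complex.norm_natCast]
  refine div_le_one_of_le₀ ?_ (Nat.cast_nonneg _)
  refine (norm_sum_le _ _).trans (le_of_eq ?_)
  simp only [norm_mul, norm_units_cast, Circle.norm_coe, mul_one, Finset.sum_const,
    Finset.card_range, nsmul_eq_mul]

theorem gtmWeight_le_one (k l : ℕ) (x : ℝ) : gtmWeight k l x ≤ 1 :=
  pow_le_one₀ (norm_nonneg _) (norm_gtmPolynomial_le_one k l x)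

theorem gtmWeight_eq_sum (k l : ℕ) (x : ℝ) :
    (gtmWeight k l x : ℂ) = (∑ a ∈ Finset.range (k + l), ∑ b ∈ Finset.range (k + l),
      (((gtmSign k a : ℤ) : ℂ) * ((gtmSign k b : ℤ) : ℂ)) * 𝐞 ((a - b) * x)) /
        ((k + l : ℕ) : ℂ) ^ 2 := by
  rw [gtmWeight, Complex.ofReal_pow, ← Complex.mul_conj', gtmPolynomial, map_div₀,
    div_mul_div_comm, map_sum, Finset.sum_mul_sum, map_natCast, ← sq]
  congr 1
  refine Finset.sum_congr rfl fun a _ => Finset.sum_congr rfl fun b _ => ?_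
  rw [sub_mul, sub_eq_add_neg, coe_fourierChar_add, coe_fourierChar_neg,
    map_mul (starRingEnd ℂ), map_intCast]
  ring

/-- Averaging the weight against a character over the `m` preimages of a point under
multiplication by `m` modulo one. -/
theorem sum_gtmWeight_mul_fourierChar {k l : ℕ} (hm : 0 < k + l) (j : ℤ) (y : ℝ) :
    ((k + l : ℕ) : ℂ) * ∑ i ∈ Finset.range (k + l), (gtmWeight k l ((y + i) / (k + l : ℕ)) : ℂ) *
        𝐞 (j * ((y + i) / (k + l : ℕ))) =
      ∑ a ∈ Finset.range (k + l),
        (((gtmSign k a * gtmSign k ((j + a) % (k + l : ℕ)).toNat : ℤˣ) : ℤ) : ℂ) *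
          𝐞 (((j + a) / (k + l : ℕ) : ℤ) * y) := by
  set m := k + l
  have hm0 : (m : ℂ) ≠ 0 := by exact_mod_cast hm.ne'
  have h1 : ∀ i : ℕ, (gtmWeight k l ((y + i) / m) : ℂ) * 𝐞 (j * ((y + i) / m)) =
      (∑ a ∈ Finset.range m, ∑ b ∈ Finset.range m,
        (((gtmSign k a : ℤ) : ℂ) * ((gtmSign k b : ℤ) : ℂ)) *
          𝐞 ((j + a - b : ℤ) * ((y + i) / m))) / (m : ℂ) ^ 2 := by
    intro i
    rw [gtmWeight_eq_sum, div_mul_eq_mul_div, Finset.sum_mul]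
    congr 1
    refine Finset.sum_congr rfl fun a _ => ?_
    rw [Finset.sum_mul]
    refine Finset.sum_congr rfl fun b _ => ?_
    rw [mul_assoc, ← coe_fourierChar_add]
    congr 4
    push_cast
    ring
  simp only [h1, ← Finset.sum_div]
  rw [Finset.sum_comm]
  simp only [Finset.sum_comm (s := Finset.range m) (t := Finset.range m)
    (f := fun i b => (((gtmSign k _ : ℤ) : ℂ) * ((gtmSign k b : ℤ) : ℂ)) *
          (𝐞 ((j + _ - b : ℤ) * ((y + i) / m)) : ℂ))]
  simp only [← Finset.mul_sum, sum_fourierChar_shift hm]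
  rw [← mul_div_assoc, div_eq_iff (pow_ne_zero 2 hm0), Finset.sum_mul, Finset.mul_sum]
  refine Finset.sum_congr rfl fun a _ => ?_
  have hmod := Int.emod_nonneg (j + a) (b := (m : ℤ)) (by omega)
  have hlt := Int.emod_lt_of_pos (j + a) (b := (m : ℤ)) (by omega)
  have hdm := Int.mul_ediv_add_emod (j + a) m
  rw [Finset.sum_eq_single ((j + a) % (m : ℤ)).toNat]
  · have h2 : j + a - (((j + a) % (m : ℤ)).toNat : ℤ) = m * ((j + a) / m) := by
      rw [Int.toNat_of_nonneg hmod]; omega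
    rw [h2, if_pos (dvd_mul_right _ _), Int.mul_ediv_cancel_left _ (by omega)]
    push_cast
    ring
  · intro b hb hne
    rw [if_neg, mul_zero]
    rw [Finset.mem_range] at hb
    intro hdvd
    apply hne
    have h3 : (b : ℤ) % m = (j + a) % (m : ℤ) := Int.modEq_iff_dvd.2 hdvd
    rw [Int.emod_eq_of_lt (by omega) (by omega)] at h3
    rw [← h3, Int.toNat_natCast]
  · intro h
    exact absurd (Finset.mem_range.2 (by omega)) h

/-! ### Periodic measures on the line -/

/-- A measure on the line that is invariant under the translation by `1` and finite on a period. -/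
structure IsPeriodicMeasure (μ : Measure ℝ) : Prop where
  map_add_one : μ.map (fun x => x + 1) = μ
  measure_Ico_ne_top : μ (Set.Ico 0 1) ≠ ⊤

/-- The Fourier coefficient `∫ exp (2 π i j x) dμ x` over one period. -/
noncomputable def periodCoeff (μ : Measure ℝ) (j : ℤ) : ℂ :=
  ∫ x in Set.Ico 0 1, (𝐞 (j * x) : ℂ) ∂μ

theorem isPeriodicMeasure_volume : IsPeriodicMeasure volume :=
  ⟨(measurePreserving_add_right volume (1 : ℝ)).map_eq, by simp⟩

namespace IsPeriodicMeasure

variable {μ : Measure ℝ}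

theorem map_add_natCast (h : IsPeriodicMeasure μ) (n : ℕ) : μ.map (fun x : ℝ => x + n) = μ := by
  induction n with
  | zero => simp
  | succ n ih =>
    have : (fun x : ℝ => x + (n + 1 : ℕ)) = (fun x => x + 1) ∘ (fun x : ℝ => x + n) := by
      ext x; simp [add_assoc]
    rw [this, ← Measure.map_map (by fun_prop) (by fun_prop), ih, h.map_add_one]

theorem map_add_intCast (h : IsPeriodicMeasure μ) (n : ℤ) : μ.map (fun x : ℝ => x + n) = μ := by
  obtain ⟨n, rfl | rfl⟩ := n.eq_nat_or_neg
  · exact_mod_cast h.map_add_natCast n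
  · conv_lhs => rw [← h.map_add_natCast n]
    rw [Measure.map_map (by fun_prop) (by fun_prop)]
    convert Measure.map_id
    ext x
    simp

theorem measure_Ico_intCast (h : IsPeriodicMeasure μ) (n : ℤ) :
    μ (Set.Ico (n : ℝ) (n + 1)) = μ (Set.Ico 0 1) := by
  conv_lhs => rw [← h.map_add_intCast n, Measure.map_apply (by fun_prop) measurableSet_Ico]
  congr 1
  ext x
  simp only [Set.mem_preimage, Set.mem_Ico]
  constructor <;> rintro ⟨h1, h2⟩ <;> constructor <;> linarith

theorem setIntegral_Ico_intCast {E : Type*} [NormedAddCommGroup E] [NormedSpace ℝ E]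
    (h : IsPeriodicMeasure μ) (n : ℤ) (g : ℝ → E) :
    ∫ x in Set.Ico (n : ℝ) (n + 1), g x ∂μ = ∫ x in Set.Ico 0 1, g (x + n) ∂μ := by
  have hemb : MeasurableEmbedding (fun x : ℝ => x + n) :=
    (MeasurableEquiv.addRight (n : ℝ)).measurableEmbedding
  conv_lhs => rw [← h.map_add_intCast n, hemb.setIntegral_map]
  congr 2
  ext x
  simp only [Set.mem_preimage, Set.mem_Ico]
  constructor <;> rintro ⟨h1, h2⟩ <;> constructor <;> linarith

theorem measure_Ico (h : IsPeriodicMeasure μ) (a : ℤ) (L : ℕ) :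
    μ (Set.Ico (a : ℝ) (a + L)) = L * μ (Set.Ico 0 1) := by
  induction L with
  | zero => simp
  | succ L ih =>
    have hcast : ((a : ℝ) + L) = ((a + L : ℤ) : ℝ) := by push_cast; ring
    rw [Nat.cast_succ, ← add_assoc,
      ← Set.Ico_union_Ico_eq_Ico (b := (a : ℝ) + L) (by simp) (by simp),
      measure_union _ measurableSet_Ico, ih, hcast, h.measure_Ico_intCast]
    · push_cast; ring
    · rw [Set.disjoint_left]
      rintro x ⟨_, h1⟩ ⟨h2, _⟩
      linarith

theorem setIntegral_Ico_natCast {E : Type*} [NormedAddCommGroup E] [NormedSpace ℝ E]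
    (h : IsPeriodicMeasure μ) (L : ℕ) (g : ℝ → E) (hg : IntegrableOn g (Set.Ico 0 (L : ℝ)) μ) :
    ∫ x in Set.Ico 0 (L : ℝ), g x ∂μ =
      ∑ i ∈ Finset.range L, ∫ x in Set.Ico 0 1, g (x + i) ∂μ := by
  induction L with
  | zero => simp
  | succ L ih =>
    rw [Nat.cast_succ] at hg ⊢
    have hu : Set.Ico (0 : ℝ) L ∪ Set.Ico (L : ℝ) (L + 1) = Set.Ico (0 : ℝ) (L + 1) :=
      Set.Ico_union_Ico_eq_Ico (by simp) (by simp)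
    rw [← hu] at hg ⊢
    rw [setIntegral_union _ measurableSet_Ico hg.left_of_union hg.right_of_union,
      ih hg.left_of_union, Finset.sum_range_succ]
    · congr 1
      exact_mod_cast h.setIntegral_Ico_intCast L g
    · rw [Set.disjoint_left]
      rintro x ⟨_, h1⟩ ⟨h2, _⟩
      linarith

theorem eq_zero (h : IsPeriodicMeasure μ)
    (h0 : μ (Set.Ico 0 1) = 0) : μ = 0 := by
  rw [← Measure.measure_univ_eq_zero, ← iUnion_Ico_intCast ℝ, measure_iUnion_null_iff]
  intro n
  rw [h.measure_Ico_intCast, h0]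

theorem isLocallyFiniteMeasure (h : IsPeriodicMeasure μ) : IsLocallyFiniteMeasure μ := by
  refine ⟨fun x => ⟨Set.Ico ((⌊x⌋ - 1 : ℤ) : ℝ) ((⌊x⌋ - 1 : ℤ) + (2 : ℕ)), ?_, ?_⟩⟩
  · refine Ico_mem_nhds ?_ ?_
    · push_cast; linarith [Int.floor_le x]
    · push_cast; linarith [Int.lt_floor_add_one x]
  · rw [h.measure_Ico]
    exact ENNReal.mul_lt_top (by simp) h.measure_Ico_ne_top.lt_top

theorem periodCoeff_zero (μ : Measure ℝ) : periodCoeff μ 0 = μ.real (Set.Ico 0 1) := by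
  simp [periodCoeff]

theorem periodCoeff_neg (μ : Measure ℝ) (j : ℤ) :
    periodCoeff μ (-j) = starRingEnd ℂ (periodCoeff μ j) := by
  rw [periodCoeff, periodCoeff, ← integral_conj]
  congr 1
  ext x
  rw [← coe_fourierChar_neg]
  push_cast
  rw [neg_mul]

/-- The integral of a test function is bounded by the mass of a period, with a constant that does
not depend on the periodic measure. -/
theorem exists_norm_integral_le (g : C_c(ℝ, ℝ)) : ∃ B : ℝ, 0 ≤ B ∧ ∀ μ : Measure ℝ,
    IsPeriodicMeasure μ → |∫ x, g x ∂μ| ≤ B * μ.real (Set.Ico 0 1) := by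
  obtain ⟨R, hR⟩ := (Metric.isBounded_iff_subset_closedBall 0).1 g.hasCompactSupport.isBounded
  obtain ⟨n, hn⟩ := exists_nat_gt R
  obtain ⟨C, hC⟩ := g.hasCompactSupport.exists_bound_of_continuous g.continuous
  have hC0 : 0 ≤ C := (norm_nonneg _).trans (hC 0)
  refine ⟨C * (2 * n : ℕ), by positivity, fun μ h => ?_⟩
  have hsupp : ∀ x ∉ Set.Ico ((-n : ℤ) : ℝ) ((-n : ℤ) + (2 * n : ℕ)), g x = 0 := by
    intro x hx
    by_contra hne
    have := hR (subset_tsupport _ hne)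
    rw [mem_closedBall_zero_iff, Real.norm_eq_abs, abs_le] at this
    refine hx ⟨?_, ?_⟩ <;> push_cast <;> linarith
  rw [← setIntegral_eq_integral_of_forall_compl_eq_zero hsupp, ← Real.norm_eq_abs]
  have hfin := h.measure_Ico (-n) (2 * n)
  refine (norm_setIntegral_le_of_norm_le_const ?_ fun x _ => hC x).trans (le_of_eq ?_)
  · rw [hfin]
    exact ENNReal.mul_lt_top (by finiteness) h.measure_Ico_ne_top.lt_top
  · rw [Measure.real, hfin, ENNReal.toReal_mul, ENNReal.toReal_natCast, Measure.real, mul_assoc]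

end IsPeriodicMeasure

/-! ### The Riesz product operator -/

/-- The operator on measures whose iterates, applied to Lebesgue measure, are the partial Riesz
products of the generalised Thue–Morse sequence: `μ` is contracted by the factor `m = k + l` and
multiplied by the weight. -/
noncomputable def rieszStep (k l : ℕ) (μ : Measure ℝ) : Measure ℝ :=
  (μ.map fun x : ℝ => x / (k + l : ℕ)).withDensity fun x => ENNReal.ofReal (gtmWeight k l x)

section RieszStep

variable {k l : ℕ} {μ : Measure ℝ}

theorem measurable_ofReal_gtmWeight (k l : ℕ) :
    Measurable fun x => ENNReal.ofReal (gtmWeight k l x) :=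
  (continuous_gtmWeight k l).measurable.ennreal_ofReal

theorem measurableEmbedding_div {m : ℕ} (hm : 0 < m) :
    MeasurableEmbedding fun x : ℝ => x / m := by
  simp only [div_eq_mul_inv]
  exact (Homeomorph.mulRight₀ (m : ℝ)⁻¹ (by positivity)).measurableEmbedding

theorem lintegral_rieszStep (hm : 0 < k + l) (μ : Measure ℝ) {g : ℝ → ENNReal}
    (hg : Measurable g) :
    ∫⁻ x, g x ∂(rieszStep k l μ) =
      ∫⁻ x, ENNReal.ofReal (gtmWeight k l (x / (k + l : ℕ))) * g (x / (k + l : ℕ)) ∂μ := by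
  rw [rieszStep, lintegral_withDensity_eq_lintegral_mul _ (measurable_ofReal_gtmWeight k l) hg,
    (measurableEmbedding_div hm).lintegral_map]
  rfl

theorem integral_rieszStep {E : Type*} [NormedAddCommGroup E] [NormedSpace ℝ E]
    (hm : 0 < k + l) (μ : Measure ℝ) (g : ℝ → E) :
    ∫ x, g x ∂(rieszStep k l μ) =
      ∫ x, gtmWeight k l (x / (k + l : ℕ)) • g (x / (k + l : ℕ)) ∂μ := by
  rw [rieszStep, integral_withDensity_eq_integral_toReal_smul (measurable_ofReal_gtmWeight k l)
    (by simp), (measurableEmbedding_div hm).integral_map]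
  simp only [ENNReal.toReal_ofReal (gtmWeight_nonneg k l _)]

theorem IsPeriodicMeasure.rieszStep (hm : 0 < k + l) (h : IsPeriodicMeasure μ) :
    IsPeriodicMeasure (rieszStep k l μ) := by
  have hm0 : ((k + l : ℕ) : ℝ) ≠ 0 := by positivity
  have := h.isLocallyFiniteMeasure
  refine ⟨Measure.ext_of_lintegral _ fun f hf => ?_, ?_⟩
  · rw [lintegral_map hf (by fun_prop), lintegral_rieszStep hm μ hf,
      lintegral_rieszStep hm μ (by fun_prop)]
    conv_rhs => rw [← h.map_add_natCast (k + l)]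
    rw [lintegral_map _ (by fun_prop)]
    · refine lintegral_congr fun x => ?_
      rw [add_div, div_self hm0, gtmWeight_add_one]
    · exact ((measurable_ofReal_gtmWeight k l).comp (by fun_prop)).mul (hf.comp (by fun_prop))
  · rw [← lintegral_indicator_one measurableSet_Ico,
      lintegral_rieszStep hm μ (measurable_one.indicator measurableSet_Ico)]
    refine ne_top_of_le_ne_top (b := μ (Set.Icc 0 (k + l : ℕ))) isCompact_Icc.measure_lt_top.ne ?_
    rw [← lintegral_indicator_one measurableSet_Icc]
    refine lintegral_mono fun x => ?_
    by_cases hx : x / (k + l : ℕ) ∈ Set.Ico (0 : ℝ) 1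
    · have hx' : x ∈ Set.Icc (0 : ℝ) (k + l : ℕ) := by
        have hpos : (0 : ℝ) < (k + l : ℕ) := by positivity
        exact ⟨by simpa using (le_div_iff₀ hpos).1 hx.1,
          by simpa using ((div_lt_iff₀ hpos).1 hx.2).le⟩
      simp only [Set.indicator_of_mem hx, Set.indicator_of_mem hx', Pi.one_apply, mul_one]
      exact ENNReal.ofReal_le_one.2 (gtmWeight_le_one k l _)
    · simp only [Set.indicator_of_notMem hx, mul_zero, zero_le]

/-- The Fourier coefficients of `rieszStep k l μ` are obtained from those of `μ` through the
renormalisation equations. -/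
theorem mul_periodCoeff_rieszStep (hm : 0 < k + l) (h : IsPeriodicMeasure μ) (j : ℤ) :
    ((k + l : ℕ) : ℂ) * periodCoeff (rieszStep k l μ) j = ∑ a ∈ Finset.range (k + l),
      (((gtmSign k a * gtmSign k ((j + a) % (k + l : ℕ)).toNat : ℤˣ) : ℤ) : ℂ) *
        periodCoeff μ ((j + a) / (k + l : ℕ)) := by
  have hpos : (0 : ℝ) < (k + l : ℕ) := by positivity
  have := h.isLocallyFiniteMeasure
  have hchar : ∀ c : ℝ, Continuous fun x : ℝ => (𝐞 (c * x) : ℂ) := fun c =>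
    continuous_coe_fourierChar.comp (continuous_const.mul continuous_id)
  set F : ℝ → ℂ := fun y => (gtmWeight k l (y / (k + l : ℕ)) : ℂ) * 𝐞 (j * (y / (k + l : ℕ)))
  have hF : Continuous F :=
    (Complex.continuous_ofReal.comp ((continuous_gtmWeight k l).comp (by fun_prop))).mul
      ((hchar j).comp (by fun_prop))
  have hint : ∀ (g : ℝ → ℂ) (a b : ℝ), Continuous g → IntegrableOn g (Set.Ico a b) μ :=
    fun g a b hg => (hg.continuousOn.integrableOn_compact isCompact_Icc).mono_set
      Set.Ico_subset_Icc_self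
  have h1 : periodCoeff (rieszStep k l μ) j = ∫ y in Set.Ico 0 ((k + l : ℕ) : ℝ), F y ∂μ := by
    rw [periodCoeff, ← integral_indicator measurableSet_Ico, integral_rieszStep hm,
      ← integral_indicator measurableSet_Ico]
    congr 1
    ext y
    have hiff : y / (k + l : ℕ) ∈ Set.Ico (0 : ℝ) 1 ↔ y ∈ Set.Ico (0 : ℝ) (k + l : ℕ) := by
      rw [Set.mem_Ico, Set.mem_Ico, le_div_iff₀ hpos, div_lt_iff₀ hpos, zero_mul, one_mul]
    by_cases hy : y ∈ Set.Ico (0 : ℝ) (k + l : ℕ)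
    · rw [Set.indicator_of_mem hy, Set.indicator_of_mem (hiff.2 hy), Complex.real_smul]
    · rw [Set.indicator_of_notMem hy, Set.indicator_of_notMem (mt hiff.1 hy), smul_zero]
  have hswap : ∑ i ∈ Finset.range (k + l), ∫ x in Set.Ico 0 1, F (x + i) ∂μ =
      ∫ x in Set.Ico 0 1, ∑ i ∈ Finset.range (k + l), F (x + i) ∂μ :=
    (integral_finsetSum _ fun (i : ℕ) _ => hint (fun x => F (x + i)) 0 1 (hF.comp (by fun_prop))).symm
  rw [h1, h.setIntegral_Ico_natCast _ _ (hint F _ _ hF), hswap, ← integral_const_mul]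
  simp only [F, sum_gtmWeight_mul_fourierChar hm]
  refine (integral_finsetSum _ fun (a : ℕ) _ =>
    hint _ _ _ (continuous_const.mul (hchar _))).trans ?_
  exact Finset.sum_congr rfl fun a _ => integral_const_mul _ _

theorem isRenormalised_periodCoeff (hm : 0 < k + l) (h : IsPeriodicMeasure μ)
    (hμ : rieszStep k l μ = μ) : IsRenormalised k l (periodCoeff μ) := fun j => by
  conv_lhs => rw [← hμ]
  exact mul_periodCoeff_rieszStep hm h j

theorem measureReal_Ico_rieszStep (hm : 0 < k + l) (h : IsPeriodicMeasure μ) :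
    (rieszStep k l μ).real (Set.Ico 0 1) = μ.real (Set.Ico 0 1) := by
  have h1 := mul_periodCoeff_rieszStep hm h 0
  have hm0 : ((k + l : ℕ) : ℂ) ≠ 0 := by exact_mod_cast hm.ne'
  have h2 : ∀ a ∈ Finset.range (k + l),
      (((gtmSign k a * gtmSign k ((0 + a : ℤ) % (k + l : ℕ)).toNat : ℤˣ) : ℤ) : ℂ) *
        periodCoeff μ ((0 + a) / (k + l : ℕ)) = periodCoeff μ 0 := by
    intro a ha
    rw [Finset.mem_range] at ha
    have h3 : ((0 + a : ℤ) % (k + l : ℕ)).toNat = a := by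
      rw [zero_add, Int.emod_eq_of_lt (by omega) (by omega), Int.toNat_natCast]
    have h4 : (0 + a : ℤ) / (k + l : ℕ) = 0 := by
      rw [zero_add, Int.ediv_eq_zero_of_lt (by omega) (by omega)]
    rw [h3, h4, Int.units_mul_self]
    simp
  rw [Finset.sum_congr rfl h2, Finset.sum_const, Finset.card_range, nsmul_eq_mul] at h1
  have h5 := mul_left_cancel₀ hm0 h1
  rw [IsPeriodicMeasure.periodCoeff_zero, IsPeriodicMeasure.periodCoeff_zero] at h5
  exact_mod_cast h5

end RieszStep

/-! ### Existence of the Riesz product measure -/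

/-- A bounded real sequence converges along every ultrafilter. -/
theorem exists_tendsto_ultrafilter_of_abs_le (𝒰 : Ultrafilter ℕ) {u : ℕ → ℝ} {B : ℝ}
    (hu : ∀ n, |u n| ≤ B) : ∃ y, Tendsto u 𝒰 (𝓝 y) := by
  obtain ⟨y, _, hy⟩ := (isCompact_Icc (a := -B) (b := B)).ultrafilter_le_nhds (𝒰.map u)
    (le_principal_iff.2 (mem_map.2 (univ_mem' fun n => abs_le.1 (hu n))))
  exact ⟨y, hy⟩

theorem isPeriodicMeasure_iterate_rieszStep {k l : ℕ} (hm : 0 < k + l) (n : ℕ) :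
    IsPeriodicMeasure ((rieszStep k l)^[n] volume) := by
  induction n with
  | zero => exact isPeriodicMeasure_volume
  | succ n ih => rw [Function.iterate_succ_apply']; exact ih.rieszStep hm

theorem measureReal_Ico_iterate_rieszStep {k l : ℕ} (hm : 0 < k + l) (n : ℕ) :
    ((rieszStep k l)^[n] volume).real (Set.Ico 0 1) = 1 := by
  induction n with
  | zero => simp [Measure.real]
  | succ n ih =>
    rw [Function.iterate_succ_apply', measureReal_Ico_rieszStep hm
      (isPeriodicMeasure_iterate_rieszStep hm n), ih]

/-- The average of the integrals of `g` against the first `N` partial Riesz products. -/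
noncomputable def rieszAverage (k l N : ℕ) (g : C_c(ℝ, ℝ)) : ℝ :=
  (N : ℝ)⁻¹ * ∑ n ∈ Finset.range N, ∫ x, g x ∂((rieszStep k l)^[n] volume)

theorem exists_abs_rieszAverage_le {k l : ℕ} (hm : 0 < k + l) (g : C_c(ℝ, ℝ)) :
    ∃ B : ℝ, (∀ n, |∫ x, g x ∂((rieszStep k l)^[n] volume)| ≤ B) ∧
      ∀ N, |rieszAverage k l N g| ≤ B := by
  obtain ⟨B, hB0, hB⟩ := IsPeriodicMeasure.exists_norm_integral_le g
  have hB' : ∀ n, |∫ x, g x ∂((rieszStep k l)^[n] volume)| ≤ B := fun n => by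
    simpa [measureReal_Ico_iterate_rieszStep hm n] using
      hB _ (isPeriodicMeasure_iterate_rieszStep hm n)
  refine ⟨B, hB', fun N => ?_⟩
  rcases Nat.eq_zero_or_pos N with rfl | hN
  · simpa [rieszAverage] using hB0
  · rw [rieszAverage, abs_mul, abs_inv, Nat.abs_cast, inv_mul_le_iff₀ (by positivity)]
    refine (Finset.abs_sum_le_sum_abs _ _).trans ((Finset.sum_le_sum fun n _ => hB' n).trans ?_)
    simp

theorem integrable_iterate_rieszStep {k l : ℕ} (hm : 0 < k + l) (n : ℕ) (g : C_c(ℝ, ℝ)) :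
    Integrable g ((rieszStep k l)^[n] volume) := by
  have := (isPeriodicMeasure_iterate_rieszStep hm n).isLocallyFiniteMeasure
  exact g.continuous.integrable_of_hasCompactSupport g.hasCompactSupport

/-- A limit, along an ultrafilter, of the averages of the partial Riesz products. -/
theorem exists_positiveLinearMap_rieszAverage {k l : ℕ} (hm : 0 < k + l) (𝒰 : Ultrafilter ℕ) :
    ∃ Λ : C_c(ℝ, ℝ) →ₚ[ℝ] ℝ, ∀ g, Tendsto (fun N => rieszAverage k l N g) 𝒰 (𝓝 (Λ g)) := by
  have hex : ∀ g : C_c(ℝ, ℝ), ∃ y, Tendsto (fun N => rieszAverage k l N g) 𝒰 (𝓝 y) := by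
    intro g
    obtain ⟨B, _, hB⟩ := exists_abs_rieszAverage_le hm g
    exact exists_tendsto_ultrafilter_of_abs_le 𝒰 hB
  choose Λ hΛ using hex
  let Λ' : C_c(ℝ, ℝ) →ₗ[ℝ] ℝ :=
    { toFun := Λ
      map_add' := fun f g => by
        refine tendsto_nhds_unique (hΛ _) (((hΛ f).add (hΛ g)).congr fun N => ?_)
        rw [rieszAverage, rieszAverage, rieszAverage, ← mul_add, ← Finset.sum_add_distrib]
        congr 1
        refine Finset.sum_congr rfl fun n _ => ?_
        rw [← integral_add (integrable_iterate_rieszStep hm n f)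
          (integrable_iterate_rieszStep hm n g)]
        rfl
      map_smul' := fun c g => by
        refine tendsto_nhds_unique (hΛ _) (((hΛ g).const_mul c).congr fun N => ?_)
        rw [rieszAverage, rieszAverage, mul_left_comm, Finset.mul_sum]
        congr 1
        refine Finset.sum_congr rfl fun n _ => ?_
        rw [← integral_const_mul]
        rfl }
  refine ⟨PositiveLinearMap.mk₀ Λ' fun g hg => ?_, hΛ⟩
  refine ge_of_tendsto' (hΛ g) fun N => ?_
  exact mul_nonneg (by positivity) (Finset.sum_nonneg fun n _ => integral_nonneg fun x => hg x)

/-- The test function `y ↦ gtmWeight k l (y / m) * g (y / m)`, the adjoint of `rieszStep k l`. -/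
noncomputable def rieszAdjoint (k l : ℕ) (hm : 0 < k + l) (g : C_c(ℝ, ℝ)) : C_c(ℝ, ℝ) where
  toFun y := gtmWeight k l (y / (k + l : ℕ)) * g (y / (k + l : ℕ))
  continuous_toFun := ((continuous_gtmWeight k l).comp (by fun_prop)).mul
    (g.continuous.comp (by fun_prop))
  hasCompactSupport' := by
    have h0 : ((k + l : ℕ) : ℝ)⁻¹ ≠ 0 := by positivity
    have h := g.hasCompactSupport.comp_homeomorph (Homeomorph.mulRight₀ _ h0)
    exact HasCompactSupport.mul_left (f := fun y : ℝ => gtmWeight k l (y / (k + l : ℕ)))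
      (by simp only [div_eq_mul_inv]; exact h)

/-- There is a periodic measure of mass `1` per period that is a fixed point of the Riesz product
operator. -/
theorem exists_isPeriodicMeasure_rieszStep_eq {k l : ℕ} (hm : 0 < k + l) :
    ∃ Γ : Measure ℝ, IsPeriodicMeasure Γ ∧ rieszStep k l Γ = Γ ∧ Γ (Set.Ico 0 1) = 1 := by
  have hfree : ((hyperfilter ℕ : Ultrafilter ℕ) : Filter ℕ) ≤ atTop := by
    rw [← Nat.cofinite_eq_atTop]; exact hyperfilter_le_cofinite
  obtain ⟨Λ, hΛ⟩ := exists_positiveLinearMap_rieszAverage hm (hyperfilter ℕ)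
  set Γ := RealRMK.rieszMeasure Λ
  have hΓ : ∀ g : C_c(ℝ, ℝ), ∫ x, g x ∂Γ = Λ g := RealRMK.integral_rieszMeasure Λ
  have hper : Γ.map (fun x => x + 1) = Γ := by
    have hreg : (Γ.map (fun x => x + 1)).Regular := Measure.Regular.map (Homeomorph.addRight (1 : ℝ))
    refine Measure.ext_of_integral_eq_on_compactlySupported fun g => ?_
    have hemb : MeasurableEmbedding (fun x : ℝ => x + 1) :=
      (MeasurableEquiv.addRight (1 : ℝ)).measurableEmbedding
    let g' : C_c(ℝ, ℝ) :=
      { toFun := fun x => g (x + 1)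
        continuous_toFun := g.continuous.comp (by fun_prop)
        hasCompactSupport' := g.hasCompactSupport.comp_homeomorph (Homeomorph.addRight (1 : ℝ)) }
    rw [hemb.integral_map]
    refine (hΓ g').trans (Eq.trans ?_ (hΓ g).symm)
    refine tendsto_nhds_unique (hΛ g') ((hΛ g).congr fun N => ?_)
    unfold rieszAverage
    congr 1
    refine Finset.sum_congr rfl fun n _ => ?_
    conv_lhs => rw [← (isPeriodicMeasure_iterate_rieszStep hm n).map_add_one, hemb.integral_map]
    rfl
  have hIco : Γ (Set.Ico 0 1) ≠ ⊤ :=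
    ((measure_mono Set.Ico_subset_Icc_self).trans_lt isCompact_Icc.measure_lt_top).ne
  have hP : IsPeriodicMeasure Γ := ⟨hper, hIco⟩
  have hstep : rieszStep k l Γ = Γ := by
    have := (hP.rieszStep hm).isLocallyFiniteMeasure
    refine Measure.ext_of_integral_eq_on_compactlySupported fun g => ?_
    have hadj : ∀ μ : Measure ℝ, ∫ x, rieszAdjoint k l hm g x ∂μ = ∫ x, g x ∂(rieszStep k l μ) :=
      fun μ => (integral_rieszStep hm μ g).symm
    rw [← hadj, hΓ, hΓ]
    obtain ⟨B, hB, _⟩ := exists_abs_rieszAverage_le hm g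
    have hdiff : Tendsto (fun N => rieszAverage k l N (rieszAdjoint k l hm g) -
        rieszAverage k l N g) (hyperfilter ℕ : Ultrafilter ℕ) (𝓝 0) := by
      -- The two averages differ only in their first and last terms.
      refine squeeze_zero_norm (a := fun N : ℕ => (N : ℝ)⁻¹ * (2 * B)) (fun N => ?_) ?_
      · rw [rieszAverage, rieszAverage, ← mul_sub, ← Finset.sum_sub_distrib]
        simp only [hadj, ← Function.iterate_succ_apply' (rieszStep k l)]
        rw [Finset.sum_range_sub (fun n => ∫ x, g x ∂((rieszStep k l)^[n] volume)), norm_mul,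
          norm_inv, Real.norm_natCast]
        gcongr
        exact (norm_sub_le _ _).trans ((add_le_add (hB N) (hB 0)).trans (two_mul B).ge)
      · have h1 : Tendsto (fun N : ℕ => (N : ℝ)⁻¹ * (2 * B)) atTop (𝓝 0) := by
          simpa using (tendsto_inv_atTop_nhds_zero_nat (𝕜 := ℝ)).mul_const (2 * B)
        exact h1.mono_left hfree
    have h2 := hdiff.add (hΛ g)
    simp only [sub_add_cancel, zero_add] at h2
    exact tendsto_nhds_unique (hΛ _) h2
  have hpos : Γ (Set.Ico 0 1) ≠ 0 := by
    intro h0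
    obtain ⟨g, hg1, -, hgc, hg01⟩ := exists_continuous_one_zero_of_isCompact
      (isCompact_Icc (a := (0 : ℝ)) (b := 1)) isClosed_empty (Set.disjoint_empty _)
    let g' : C_c(ℝ, ℝ) := ⟨g, hgc⟩
    have hle : ∀ n, 1 ≤ ∫ x, g' x ∂((rieszStep k l)^[n] volume) := by
      intro n
      have hloc := (isPeriodicMeasure_iterate_rieszStep hm n).isLocallyFiniteMeasure
      have h1 : ∫ x in Set.Ico (0 : ℝ) 1, g' x ∂((rieszStep k l)^[n] volume) = 1 := by
        rw [setIntegral_congr_fun (f := g') (g := fun _ => (1 : ℝ)) measurableSet_Ico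
          (fun x hx => hg1 (Set.Ico_subset_Icc_self hx)), setIntegral_const,
          measureReal_Ico_iterate_rieszStep hm, one_smul]
      rw [← h1]
      exact setIntegral_le_integral (integrable_iterate_rieszStep hm n g')
        (Eventually.of_forall fun x => (hg01 x).1)
    have h1 : 1 ≤ Λ g' := by
      refine ge_of_tendsto (hΛ g') (hfree ?_)
      filter_upwards [eventually_gt_atTop 0] with N hN
      rw [rieszAverage, le_inv_mul_iff₀ (by positivity), mul_one]
      refine le_trans ?_ (Finset.sum_le_sum fun n _ => hle n)
      simp
    rw [← hΓ, hP.eq_zero h0, integral_zero_measure] at h1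
    linarith
  have hc : (Γ (Set.Ico 0 1))⁻¹ ≠ ⊤ := ENNReal.inv_ne_top.2 hpos
  refine ⟨(Γ (Set.Ico 0 1))⁻¹ • Γ, ⟨?_, ?_⟩, ?_, ?_⟩
  · rw [Measure.map_smul, hper]
  · rw [Measure.smul_apply, smul_eq_mul, ENNReal.inv_mul_cancel hpos hIco]; simp
  · rw [rieszStep, Measure.map_smul, withDensity_smul_measure]
    exact congrArg _ hstep
  · rw [Measure.smul_apply, smul_eq_mul, ENNReal.inv_mul_cancel hpos hIco]

/-! ### The Fourier transform of the comb of Fourier coefficients -/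

theorem IsPeriodicMeasure.hasTemperateGrowth {μ : Measure ℝ} (h : IsPeriodicMeasure μ) :
    μ.HasTemperateGrowth := by
  refine ⟨⟨2, ?_, ?_⟩⟩
  · have : Continuous fun x : ℝ => (1 + ‖x‖) ^ (-((2 : ℕ) : ℝ)) :=
      Continuous.rpow_const (by fun_prop) fun x => Or.inl (by positivity)
    exact this.aestronglyMeasurable
  have hbound : ∀ n : ℤ, ∫⁻ x in Set.Ico (n : ℝ) (n + 1), ‖(1 + ‖x‖) ^ (-((2 : ℕ) : ℝ))‖ₑ ∂μ ≤
      ENNReal.ofReal (4 * ((1 + |(n : ℝ)|) ^ 2)⁻¹) * μ (Set.Ico 0 1) := by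
    intro n
    rw [← h.measure_Ico_intCast n, ← setLIntegral_const]
    refine setLIntegral_mono measurable_const fun x hx => ?_
    rw [← ofReal_norm]
    refine ENNReal.ofReal_le_ofReal ?_
    rw [Real.norm_of_nonneg (by positivity), Real.rpow_neg (by positivity), Real.rpow_natCast,
      Real.norm_eq_abs, ← div_eq_mul_inv, ← one_div, div_le_div_iff₀ (by positivity) (by positivity)]
    have h1 : 1 + |(n : ℝ)| ≤ 2 * (1 + |x|) := by
      have h2 : |(n : ℝ) - x| ≤ 1 := abs_le.2 ⟨by linarith [hx.2], by linarith [hx.1]⟩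
      have h3 := abs_add_le ((n : ℝ) - x) x
      rw [sub_add_cancel] at h3
      linarith [abs_nonneg x]
    calc 1 * (1 + |(n : ℝ)|) ^ 2 ≤ 1 * (2 * (1 + |x|)) ^ 2 := by gcongr
      _ = 4 * (1 + |x|) ^ 2 := by ring
  have hsum : Summable fun n : ℤ => 4 * ((1 + |(n : ℝ)|) ^ 2)⁻¹ := by
    refine Summable.mul_left _ (Summable.of_norm_bounded_eventually
      (Real.summable_one_div_int_pow.2 one_lt_two) ?_)
    filter_upwards [(Set.finite_singleton (0 : ℤ)).compl_mem_cofinite] with n hn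
    have hn0 : (0 : ℝ) < |(n : ℝ)| := abs_pos.2 (by exact_mod_cast hn)
    rw [Real.norm_of_nonneg (by positivity), one_div, ← sq_abs (n : ℝ)]
    gcongr
    linarith
  rw [HasFiniteIntegral, ← setLIntegral_univ, ← iUnion_Ico_intCast ℝ,
    lintegral_iUnion (fun _ => measurableSet_Ico) (Set.pairwise_disjoint_Ico_intCast ℝ)]
  refine (ENNReal.tsum_le_tsum hbound).trans_lt ?_
  rw [ENNReal.tsum_mul_right]
  exact ENNReal.mul_lt_top hsum.tsum_ofReal_lt_top h.measure_Ico_ne_top.lt_top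

/-- Unfolding an integral over the line to one over a period. -/
theorem IsPeriodicMeasure.integral_eq_integral_tsum {μ : Measure ℝ} (h : IsPeriodicMeasure μ)
    {g : ℝ → ℂ} (hg : Integrable g μ) :
    ∫ x, g x ∂μ = ∫ x in Set.Ico 0 1, ∑' n : ℤ, g (x + n) ∂μ := by
  have hsum : ∀ {E : Type} [NormedAddCommGroup E] [NormedSpace ℝ E] {g : ℝ → E},
      Integrable g μ → HasSum (fun n : ℤ => ∫ x in Set.Ico 0 1, g (x + n) ∂μ) (∫ x, g x ∂μ) := by
    intro E _ _ g hg
    have h1 := hasSum_integral_iUnion (fun n : ℤ => measurableSet_Ico)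
      (Set.pairwise_disjoint_Ico_intCast ℝ) (hg.integrableOn (s := ⋃ n : ℤ, Set.Ico (n : ℝ) (n + 1)))
    simpa only [h.setIntegral_Ico_intCast, iUnion_Ico_intCast, setIntegral_univ] using h1
  have hint : ∀ n : ℤ, Integrable (fun x => g (x + n)) (μ.restrict (Set.Ico 0 1)) := by
    intro n
    have hemb : MeasurableEmbedding (fun x : ℝ => x + n) :=
      (MeasurableEquiv.addRight (n : ℝ)).measurableEmbedding
    have h1 : Integrable (g ∘ fun x : ℝ => x + n) μ := by
      rw [← hemb.integrable_map_iff, h.map_add_intCast]; exact hg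
    exact h1.integrableOn
  rw [← (hsum hg).tsum_eq]
  exact integral_tsum_of_summable_integral_norm hint (hsum hg.norm).summable

theorem coe_fourier_eq_fourierChar (n : ℤ) (x : ℝ) :
    fourier n (x : UnitAddCircle) = (𝐞 (n * x) : ℂ) := by
  rw [fourier_coe_apply, Real.fourierChar_apply]
  congr 1
  push_cast
  ring

/-- By Poisson summation, the Fourier transform of the comb whose weights are the Fourier
coefficients of a periodic measure is that measure. -/
theorem IsPeriodicMeasure.isFourierTransform {μ : Measure ℝ} (h : IsPeriodicMeasure μ) :
    IsFourierTransform (diracComb (periodCoeff μ)) μ := by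
  have hμ := h.hasTemperateGrowth
  have hloc := h.isLocallyFiniteMeasure
  refine ⟨hμ, 𝓕⁻ μ.toTemperedDistribution, fun φ hφ => ?_, FourierTransform.fourier_fourierInv_eq _⟩
  change ∫ x, (𝓕⁻ φ) x ∂μ = _
  rw [h.integral_eq_integral_tsum (SchwartzMap.integrable _)]
  set g : C_c(ℝ, ℂ) := ⟨⟨φ, φ.continuous⟩, hφ⟩
  set s := (finite_int_preimage g.hasCompactSupport.isCompact).toFinset
  have hs : ∀ n : ℤ, g n ≠ 0 → n ∈ s := fun n hn => by simpa [s] using subset_tsupport _ hn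
  rw [diracComb_apply_eq_sum _ g hs]
  have hpoisson : ∀ x : ℝ, ∑' n : ℤ, (𝓕⁻ φ) (x + n) = ∑ n ∈ s, φ n * (𝐞 (n * x) : ℂ) := by
    intro x
    rw [SchwartzMap.tsum_eq_tsum_fourier, FourierTransform.fourier_fourierInv_eq,
      tsum_eq_sum (s := s)]
    · simp only [coe_fourier_eq_fourierChar]
    · intro n hn
      have : φ n = 0 := by
        by_contra h0
        exact hn (hs n h0)
      rw [this, zero_mul]
  simp only [hpoisson]
  have hchar : ∀ n : ℤ, Continuous fun x : ℝ => (𝐞 (n * x) : ℂ) := fun n =>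
    continuous_coe_fourierChar.comp (continuous_const.mul continuous_id)
  refine (integral_finsetSum _ fun (n : ℤ) _ => ?_).trans ?_
  · exact ((continuous_const.mul (hchar n)).continuousOn.integrableOn_compact
      isCompact_Icc).mono_set Set.Ico_subset_Icc_self
  · refine Finset.sum_congr rfl fun n _ => ?_
    rw [mul_comm]
    exact integral_const_mul _ _

/-! ### Uniqueness of the Fourier transform -/

/-- Every Schwartz function is a limit, in the Schwartz space, of Schwartz functions of compact
support. -/
theorem SchwartzMap.exists_tendsto_hasCompactSupport (φ : 𝓢(ℝ, ℂ)) :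
    ∃ ψ : ℕ → 𝓢(ℝ, ℂ), (∀ n, HasCompactSupport (ψ n)) ∧ Tendsto ψ atTop (𝓝 φ) := by
  let χ : ContDiffBump (0 : ℝ) := ⟨1, 2, one_pos, one_lt_two⟩
  set u : ℝ → ℝ := fun x => 1 - χ x with hu
  have hus : ∀ n : ℕ∞, ContDiff ℝ n u := fun n => contDiff_const.sub χ.contDiff
  -- All derivatives of `u = 1 - χ` are bounded.
  have hC : ∀ i : ℕ, ∃ C : ℝ, ∀ x, ‖iteratedDeriv i u x‖ ≤ C := by
    intro i
    rcases Nat.eq_zero_or_pos i with rfl | hi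
    · refine ⟨1, fun x => ?_⟩
      rw [iteratedDeriv_zero, Real.norm_eq_abs, abs_le]
      have h1 : 0 ≤ χ x := χ.nonneg
      have h2 : χ x ≤ 1 := χ.le_one
      constructor <;> simp only [hu] <;> linarith
    · obtain ⟨C, hC⟩ := (χ.hasCompactSupport.iteratedFDeriv (𝕜 := ℝ) i).exists_bound_of_continuous
        ((χ.contDiff (n := i)).continuous_iteratedFDeriv le_rfl)
      refine ⟨C, fun x => ?_⟩
      rw [iteratedDeriv_const_sub hi, iteratedDeriv_neg, norm_neg,
        ← norm_iteratedFDeriv_eq_norm_iteratedDeriv]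
      exact hC x
  choose C hC using hC
  have hC0 : ∀ i, 0 ≤ C i := fun i => (norm_nonneg _).trans (hC i 0)
  set r : ℕ → ℝ := fun n => ((n : ℝ) + 1)⁻¹ with hr
  have hr0 : ∀ n, 0 < r n := fun n => by positivity
  have hr1 : ∀ n, r n ≤ 1 := fun n => inv_le_one_of_one_le₀ (by linarith [n.cast_nonneg (α := ℝ)])
  have hsc : ∀ n, HasCompactSupport fun x : ℝ => χ (r n * x) • φ x := fun n =>
    HasCompactSupport.smul_right (f := fun x : ℝ => χ (r n * x))
      (χ.hasCompactSupport.comp_homeomorph (Homeomorph.mulLeft₀ (r n) (hr0 n).ne'))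
  have hsm : ∀ n, ContDiff ℝ (⊤ : ℕ∞) fun x : ℝ => χ (r n * x) • φ x := fun n =>
    (χ.contDiff.comp (contDiff_const.mul contDiff_id)).smul (φ.smooth ⊤)
  refine ⟨fun n => (hsc n).toSchwartzMap (hsm n), hsc,
    ((schwartz_withSeminorms ℝ ℝ ℂ).tendsto_nhds _ _).2 ?_⟩
  rintro ⟨k, n⟩ ε hε
  set M : ℝ := ∑ i ∈ Finset.range (n + 1),
    (n.choose i : ℝ) * C i * SchwartzMap.seminorm ℝ (k + 1) (n - i) φ with hM
  have hM0 : 0 ≤ M := Finset.sum_nonneg fun i _ => by have := hC0 i; positivity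
  have hle : ∀ N, SchwartzMap.seminorm ℝ k n ((hsc N).toSchwartzMap (hsm N) - φ) ≤ r N * M := by
    intro N
    rw [← map_neg_eq_map, neg_sub]
    refine SchwartzMap.seminorm_le_bound ℝ k n _ (mul_nonneg (hr0 N).le hM0) fun x => ?_
    have hfun : ⇑(φ - (hsc N).toSchwartzMap (hsm N)) = fun y => u (r N * y) • φ y := by
      ext y
      change φ y - χ (r N * y) • φ y = (1 - χ (r N * y)) • φ y
      rw [sub_smul, one_smul]
    rw [hfun]
    rcases lt_or_ge |x| (r N)⁻¹ with hx | hx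
    · -- The difference vanishes on a neighbourhood of `x`.
      have hzero : (fun y => u (r N * y) • φ y) =ᶠ[𝓝 x] fun _ => 0 := by
        filter_upwards [continuous_abs.continuousAt.eventually_lt_const hx] with y hy
        have h1 : χ (r N * y) = 1 := χ.one_of_mem_closedBall <| by
          rw [mem_closedBall_zero_iff, norm_mul, Real.norm_of_nonneg (hr0 N).le, Real.norm_eq_abs]
          exact ((lt_inv_mul_iff₀ (hr0 N)).1 (by change |y| < (r N)⁻¹ * 1; simpa using hy)).le
        simp [hu, h1]
      rw [(hzero.iteratedFDeriv ℝ n).self_of_nhds, iteratedFDeriv_fun_zero]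
      simpa using mul_nonneg (hr0 N).le hM0
    · have hleib := norm_iteratedFDeriv_smul_le (𝕜 := ℝ) (N := n) (n := n)
        (((hus n).comp (contDiff_const.mul contDiff_id) : ContDiff ℝ n fun y => u (r N * y)))
        (φ.smooth n) x le_rfl
      have h1 : 1 ≤ r N * ‖x‖ := by
        rwa [Real.norm_eq_abs, ← inv_le_iff_one_le_mul₀' (hr0 N)]
      calc ‖x‖ ^ k * ‖iteratedFDeriv ℝ n (fun y => u (r N * y) • φ y) x‖
          ≤ (r N * ‖x‖) * (‖x‖ ^ k * ∑ i ∈ Finset.range (n + 1), (n.choose i : ℝ) *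
              ‖iteratedFDeriv ℝ i (fun y => u (r N * y)) x‖ *
                ‖iteratedFDeriv ℝ (n - i) φ x‖) := by
            refine (le_mul_of_one_le_left (by positivity) h1).trans ?_
            gcongr
            exact hleib
        _ = r N * ∑ i ∈ Finset.range (n + 1), (n.choose i : ℝ) *
              ‖iteratedFDeriv ℝ i (fun y => u (r N * y)) x‖ *
                (‖x‖ ^ (k + 1) * ‖iteratedFDeriv ℝ (n - i) φ x‖) := by
            rw [mul_assoc, ← mul_assoc ‖x‖, ← pow_succ', Finset.mul_sum]
            congr 1
            exact Finset.sum_congr rfl fun i _ => by ring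
        _ ≤ r N * M := by
            refine mul_le_mul_of_nonneg_left (Finset.sum_le_sum fun i _ => ?_) (hr0 N).le
            gcongr
            · exact mul_nonneg (Nat.cast_nonneg _) (hC0 i)
            · rw [norm_iteratedFDeriv_eq_norm_iteratedDeriv, iteratedDeriv_comp_const_mul (hus i),
                norm_mul, norm_pow, Real.norm_of_nonneg (hr0 N).le]
              exact (mul_le_of_le_one_left (norm_nonneg _)
                (pow_le_one₀ (hr0 N).le (hr1 N))).trans (hC i _)
            · exact SchwartzMap.le_seminorm ℝ (k + 1) (n - i) φ x
  have hlim : Tendsto (fun N => r N * M) atTop (𝓝 0) := by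
    simpa [hr] using (tendsto_one_div_add_atTop_nhds_zero_nat (𝕜 := ℝ)).mul_const M
  filter_upwards [hlim.eventually_lt_const hε] with N hN
  exact (hle N).trans_lt hN

/-- Tempered measures with the same integrals of Schwartz functions coincide. -/
theorem MeasureTheory.Measure.ext_of_integral_schwartzMap {μ ν : Measure ℝ}
    [μ.HasTemperateGrowth] [ν.HasTemperateGrowth]
    (h : ∀ φ : 𝓢(ℝ, ℂ), ∫ x, φ x ∂μ = ∫ x, φ x ∂ν) : μ = ν := by
  have hcover : (⋃ n : ℕ, Metric.closedBall (0 : ℝ) n) = Set.univ :=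
    Metric.iUnion_closedBall_nat 0
  refine (Measure.ext_iff_of_iUnion_eq_univ hcover).2 fun n => ?_
  -- Both measures, multiplied by a bump function, have the same characteristic function.
  let χ : ContDiffBump (0 : ℝ) := ⟨n + 1, n + 2, by positivity, by linarith⟩
  have hsc : ∀ t : ℝ, HasCompactSupport fun x : ℝ => χ x • Complex.exp (t * x * Complex.I) :=
    fun t => HasCompactSupport.smul_right (f := χ) χ.hasCompactSupport
  have hsm : ∀ t : ℝ, ContDiff ℝ (⊤ : ℕ∞)
      fun x : ℝ => χ x • Complex.exp (t * x * Complex.I) := fun t =>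
    χ.contDiff.smul ((((contDiff_const.mul Complex.ofRealCLM.contDiff).mul contDiff_const)).cexp)
  have hmeas : Measurable fun x => ENNReal.ofReal (χ x) :=
    χ.continuous.measurable.ennreal_ofReal
  have hfin : ∀ (ρ : Measure ℝ) [ρ.HasTemperateGrowth],
      IsFiniteMeasure (ρ.withDensity fun x => ENNReal.ofReal (χ x)) := by
    intro ρ _
    refine isFiniteMeasure_withDensity_ofReal ?_
    have h1 := (((hsc 0).toSchwartzMap (hsm 0)).integrable (μ := ρ)).2
    refine h1.mono (Eventually.of_forall fun x => ?_)
    change ‖χ x‖ ≤ ‖χ x • Complex.exp ((0 : ℝ) * x * Complex.I)‖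
    simp
  have hμ := hfin μ
  have hν := hfin ν
  have hchar : ∀ (ρ : Measure ℝ) (t : ℝ),
      charFun (ρ.withDensity fun x => ENNReal.ofReal (χ x)) t =
        ∫ x, (hsc t).toSchwartzMap (hsm t) x ∂ρ := by
    intro ρ t
    rw [charFun_apply_real, integral_withDensity_eq_integral_toReal_smul hmeas (by simp)]
    simp only [ENNReal.toReal_ofReal χ.nonneg]
    rfl
  have heq := Measure.ext_of_charFun (μ := μ.withDensity fun x => ENNReal.ofReal (χ x))
    (ν := ν.withDensity fun x => ENNReal.ofReal (χ x)) (funext fun t => by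
      rw [hchar, hchar, h])
  have hres : ∀ ρ : Measure ℝ, (ρ.withDensity fun x => ENNReal.ofReal (χ x)).restrict
      (Metric.closedBall (0 : ℝ) n) = ρ.restrict (Metric.closedBall (0 : ℝ) n) := by
    intro ρ
    rw [restrict_withDensity Metric.isClosed_closedBall.measurableSet]
    conv_rhs => rw [← withDensity_one (μ := ρ.restrict (Metric.closedBall (0 : ℝ) n))]
    refine withDensity_congr_ae ?_
    filter_upwards [ae_restrict_mem Metric.isClosed_closedBall.measurableSet] with x hx
    have : χ x = 1 := χ.one_of_mem_closedBall
      (Metric.closedBall_subset_closedBall (by simp [χ]) hx)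
    simp [this]
  rw [← hres μ, ← hres ν, heq]

theorem IsFourierTransform.unique {γ : ComplexRadonMeasure} {μ ν : Measure ℝ}
    (hμ : IsFourierTransform γ μ) (hν : IsFourierTransform γ ν) : μ = ν := by
  obtain ⟨hμt, T, hT, hTμ⟩ := hμ
  obtain ⟨hνt, S, hS, hSν⟩ := hν
  have hTS : ∀ φ : 𝓢(ℝ, ℂ), T φ = S φ := by
    intro φ
    obtain ⟨ψ, hψ, hlim⟩ := φ.exists_tendsto_hasCompactSupport
    have h1 := (T.continuous.tendsto φ).comp hlim
    have h2 := (S.continuous.tendsto φ).comp hlim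
    refine tendsto_nhds_unique h1 (h2.congr fun n => ?_)
    exact (hS _ (hψ n)).trans (hT _ (hψ n)).symm
  refine Measure.ext_of_integral_schwartzMap fun φ => ?_
  change μ.toTemperedDistribution φ = ν.toTemperedDistribution φ
  rw [← hTμ, ← hSν]
  exact hTS _

/-! ### Solutions of the renormalisation equations -/

theorem IsRenormalised.apply_mul {k l : ℕ} {η : ℤ → ℂ} (hη : IsRenormalised k l η)
    (hm : 0 < k + l) (j : ℤ) : η ((k + l : ℕ) * j) = η j := by
  have h1 := hη ((k + l : ℕ) * j)
  have hm0 : ((k + l : ℕ) : ℂ) ≠ 0 := by exact_mod_cast hm.ne'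
  have h2 : ∀ a ∈ Finset.range (k + l),
      (((gtmSign k a * gtmSign k ((((k + l : ℕ) * j + a : ℤ)) % (k + l : ℕ)).toNat : ℤˣ) : ℤ) : ℂ) *
        η (((k + l : ℕ) * j + a) / (k + l : ℕ)) = η j := by
    intro a ha
    rw [Finset.mem_range] at ha
    rw [Int.mul_add_emod_self_left, Int.emod_eq_of_lt (by omega) (by omega), Int.toNat_natCast,
      Int.mul_add_ediv_left _ _ (by omega), Int.ediv_eq_zero_of_lt (by omega) (by omega),
      Int.units_mul_self]
    simp
  rw [Finset.sum_congr rfl h2, Finset.sum_const, Finset.card_range, nsmul_eq_mul] at h1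
  exact mul_left_cancel₀ hm0 h1

/-- A solution of the renormalisation equations that decays at infinity vanishes at `0`: it is
constant along `j, m j, m ^ 2 j, …`, hence zero away from `0`, and the equation at `m - 1` expresses
its value at `0` through other values. -/
theorem IsRenormalised.apply_zero_eq_zero {k l : ℕ} (hk : 1 ≤ k) (hl : 1 ≤ l) {η : ℤ → ℂ}
    (hη : IsRenormalised k l η) (hlim : Tendsto (fun n : ℕ => η n) atTop (𝓝 0)) : η 0 = 0 := by
  have hm : 2 ≤ k + l := by omega
  have hpos : ∀ j : ℕ, 0 < j → η j = 0 := by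
    intro j hj
    have hconst : ∀ n : ℕ, η (((k + l) ^ n * j : ℕ)) = η j := by
      intro n
      induction n with
      | zero => simp
      | succ n ih =>
        rw [← ih, ← hη.apply_mul (by omega) (((k + l) ^ n * j : ℕ))]
        congr 1
        push_cast
        ring
    have htop : Tendsto (fun n : ℕ => (k + l) ^ n * j) atTop atTop :=
      (tendsto_pow_atTop_atTop_of_one_lt hm).atTop_mul_const' hj
    refine tendsto_nhds_unique ?_ (hlim.comp htop)
    simp only [Function.comp_def, hconst]
    exact tendsto_const_nhds
  have h1 := hη ((k + l - 1 : ℕ))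
  rw [hpos _ (by omega), mul_zero, Finset.sum_eq_single 0] at h1
  · rw [Nat.cast_zero, add_zero, Int.ediv_eq_zero_of_lt (by omega) (by omega)] at h1
    refine (mul_eq_zero.1 h1.symm).resolve_left fun h => ?_
    have := norm_units_cast (gtmSign k 0 *
      gtmSign k ((((k + l - 1 : ℕ) : ℤ)) % (k + l : ℕ)).toNat)
    rw [h, norm_zero] at this
    exact zero_ne_one this
  · intro a ha ha0
    rw [Finset.mem_range] at ha
    have h2 : (((k + l - 1 : ℕ) : ℤ) + a) / (k + l : ℕ) = (1 : ℕ) := by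
      rw [Int.ediv_eq_iff_of_pos (by omega)]
      constructor <;> push_cast <;> omega
    rw [h2, hpos 1 one_pos, mul_zero]
  · intro h
    exact absurd (Finset.mem_range.2 (by omega)) h

/-- A solution of the renormalisation equations is determined, on the natural numbers, by its value
at `0`. -/
theorem IsRenormalised.eq_zero {k l : ℕ} (hk : 1 ≤ k) (hl : 1 ≤ l) {η : ℤ → ℂ}
    (hη : IsRenormalised k l η) (h0 : η 0 = 0) (j : ℕ) : η j = 0 := by
  have hm : 2 ≤ k + l := by omega
  have hm0 : ((k + l : ℕ) : ℂ) ≠ 0 := by exact_mod_cast (by omega : k + l ≠ 0)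
  induction j using Nat.strong_induction_on with
  | _ j ih =>
  have hcast : ∀ a : ℕ, ((j : ℤ) + a) / (k + l : ℕ) = ((j + a) / (k + l) : ℕ) := fun a => by
    push_cast; rfl
  rcases Nat.lt_or_ge 1 j with hj | hj
  · have h1 := hη j
    rw [Finset.sum_eq_zero] at h1
    · exact (mul_eq_zero.1 h1).resolve_left hm0
    · intro a ha
      rw [Finset.mem_range] at ha
      have hlt : (j + a) / (k + l) < j := by
        rw [Nat.div_lt_iff_lt_mul (by omega)]; nlinarith
      rw [hcast, ih _ hlt, mul_zero]
  · rcases Nat.eq_zero_or_pos j with rfl | hj0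
    · exact_mod_cast h0
    obtain rfl : j = 1 := by omega
    -- Only the last term of the equation at `1` survives, so `m * ‖η 1‖ = ‖η 1‖`.
    have h1 := hη (1 : ℕ)
    rw [Finset.sum_eq_single (k + l - 1)] at h1
    · rw [hcast, show (1 + (k + l - 1)) / (k + l) = 1 by
        rw [show 1 + (k + l - 1) = k + l by omega, Nat.div_self (by omega)]] at h1
      have h2 := congrArg norm h1
      rw [norm_mul, norm_mul, norm_units_cast, Complex.norm_natCast, one_mul] at h2
      have h3 : (2 : ℝ) ≤ (k + l : ℕ) := by exact_mod_cast hm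
      have h4 : ‖η (1 : ℕ)‖ = 0 := by nlinarith [norm_nonneg (η (1 : ℕ))]
      exact norm_eq_zero.1 h4
    · intro a ha hne
      rw [Finset.mem_range] at ha
      rw [hcast, Nat.div_eq_of_lt (by omega), Nat.cast_zero, h0, mul_zero]
    · intro h
      exact absurd (Finset.mem_range.2 (by omega)) h

/-- The Fourier coefficients of a self-similar periodic measure are real, so that they form an even
sequence. -/
theorem periodCoeff_neg_of_rieszStep_eq {k l : ℕ} (hk : 1 ≤ k) (hl : 1 ≤ l) {μ : Measure ℝ}
    (h : IsPeriodicMeasure μ) (hμ : rieszStep k l μ = μ) (j : ℤ) :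
    periodCoeff μ (-j) = periodCoeff μ j := by
  have hη := isRenormalised_periodCoeff (by omega) h hμ
  have hδ : IsRenormalised k l fun j => periodCoeff μ j - periodCoeff μ (-j) := by
    intro j
    have h1 := hη j
    have h2 := congrArg (starRingEnd ℂ) h1
    simp only [map_mul, map_sum, map_natCast, map_intCast,
      ← IsPeriodicMeasure.periodCoeff_neg] at h2
    simp only [mul_sub, Finset.sum_sub_distrib]
    rw [h1, h2]
  have hzero := hδ.eq_zero hk hl (by simp)
  obtain ⟨n, rfl | rfl⟩ := j.eq_nat_or_neg
  · exact (sub_eq_zero.1 (hzero n)).symm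
  · rw [neg_neg]; exact sub_eq_zero.1 (hzero n)

/-! ### Singularity -/

/-- An additive map of measures that preserves singularity and absolute continuity, and that fixes
`μ`, fixes the absolutely continuous part of `μ`. -/
theorem map_withDensity_rnDeriv_eq {T : Measure ℝ → Measure ℝ}
    (hadd : ∀ μ ν, T (μ + ν) = T μ + T ν)
    (hsing : ∀ μ : Measure ℝ, μ ⟂ₘ volume → T μ ⟂ₘ volume)
    (hac : ∀ μ : Measure ℝ, μ ≪ volume → T μ ≪ volume)
    {μ : Measure ℝ} [SigmaFinite μ] (hμ : T μ = μ) :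
    T (volume.withDensity (μ.rnDeriv volume)) = volume.withDensity (μ.rnDeriv volume) := by
  set a := volume.withDensity (μ.rnDeriv volume)
  have hdec : μ = T (μ.singularPart volume) + T a := by
    conv_lhs => rw [← hμ, ← μ.singularPart_add_rnDeriv volume]
    exact hadd _ _
  have hle : T a ≤ μ := by
    conv_rhs => rw [hdec]
    exact Measure.le_add_left le_rfl
  have : SigmaFinite (T a) := Measure.sigmaFinite_of_le μ hle
  have hTa := Measure.withDensity_rnDeriv_eq (T a) volume (hac _ (withDensity_absolutelyContinuous _ _))
  rw [← hTa] at hdec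
  rw [← hTa]
  exact Measure.eq_withDensity_rnDeriv (Measure.measurable_rnDeriv _ _)
    (hsing _ (Measure.mutuallySingular_singularPart _ _)) hdec

theorem rieszStep_add (k l : ℕ) (μ ν : Measure ℝ) :
    rieszStep k l (μ + ν) = rieszStep k l μ + rieszStep k l ν := by
  rw [rieszStep, Measure.map_add _ _ (by fun_prop), withDensity_add_measure]
  rfl

theorem volume_preimage_div_eq_zero {m : ℕ} (hm : 0 < m) {s : Set ℝ} (hs : volume s = 0) :
    volume ((fun x : ℝ => x / m) ⁻¹' s) = 0 := by
  simp only [div_eq_mul_inv]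
  rw [Real.volume_preimage_mul_right (by positivity), hs, mul_zero]

theorem rieszStep_absolutelyContinuous {k l : ℕ} (hm : 0 < k + l) {μ : Measure ℝ}
    (h : μ ≪ volume) : rieszStep k l μ ≪ volume := by
  refine (withDensity_absolutelyContinuous _ _).trans (Measure.AbsolutelyContinuous.mk
    fun s hs h0 => ?_)
  rw [Measure.map_apply (by fun_prop) hs]
  exact h (volume_preimage_div_eq_zero hm h0)

theorem rieszStep_mutuallySingular {k l : ℕ} (hm : 0 < k + l) {μ : Measure ℝ}
    (h : μ ⟂ₘ volume) : rieszStep k l μ ⟂ₘ volume := by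
  refine Measure.MutuallySingular.mono_ac ?_ (withDensity_absolutelyContinuous _ _)
    Measure.AbsolutelyContinuous.rfl
  obtain ⟨s, hs, hμ, hv⟩ := h
  have hm0 : ((k + l : ℕ) : ℝ) ≠ 0 := by positivity
  refine ⟨(fun x : ℝ => (k + l : ℕ) * x) ⁻¹' s, hs.preimage (by fun_prop), ?_, ?_⟩
  · rw [Measure.map_apply (by fun_prop) (hs.preimage (by fun_prop)), ← Set.preimage_comp]
    convert hμ
    ext x
    simp only [Set.mem_preimage, Function.comp_apply, mul_div_cancel₀ _ hm0]
  · rw [← Set.preimage_compl, Real.volume_preimage_mul_left hm0, hv, mul_zero]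

theorem tendsto_periodCoeff_withDensity {f : ℝ → ENNReal} (hf : Measurable f)
    (hfin : ∀ᵐ x, f x < ⊤) :
    Tendsto (fun n : ℕ => periodCoeff (volume.withDensity f) n) atTop (𝓝 0) := by
  have hRL := Real.tendsto_integral_exp_smul_cocompact
    ((Set.Ico (0 : ℝ) 1).indicator fun x => ((f x).toReal : ℂ))
  have hcoc : Tendsto (fun n : ℕ => -(n : ℝ)) atTop (cocompact ℝ) :=
    (tendsto_neg_atTop_atBot.comp tendsto_natCast_atTop_atTop).mono_right
      (by rw [cocompact_eq_atBot_atTop]; exact le_sup_left)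
  refine (hRL.comp hcoc).congr fun n => ?_
  rw [periodCoeff, ← integral_indicator measurableSet_Ico,
    integral_withDensity_eq_integral_toReal_smul hf hfin]
  refine integral_congr_ae (Eventually.of_forall fun x => ?_)
  by_cases hx : x ∈ Set.Ico (0 : ℝ) 1
  · simp only [Set.indicator_of_mem hx, Circle.smul_def, smul_eq_mul, Complex.real_smul]
    rw [mul_comm, mul_neg, neg_neg, mul_comm x]
    simp
  · simp only [Set.indicator_of_notMem hx, smul_zero]

/-- A self-similar periodic measure is singular: its absolutely continuous part is again periodic
and self-similar, and its Fourier coefficients decay by the Riemann–Lebesgue lemma. -/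
theorem mutuallySingular_of_rieszStep_eq {k l : ℕ} (hk : 1 ≤ k) (hl : 1 ≤ l) {μ : Measure ℝ}
    (h : IsPeriodicMeasure μ) (hμ : rieszStep k l μ = μ) : μ ⟂ₘ volume := by
  have hm : 0 < k + l := by omega
  have := h.isLocallyFiniteMeasure
  set a := volume.withDensity (μ.rnDeriv volume) with ha
  have hstep : rieszStep k l a = a := map_withDensity_rnDeriv_eq (rieszStep_add k l)
    (fun _ => rieszStep_mutuallySingular hm) (fun _ => rieszStep_absolutelyContinuous hm) hμ
  have hshift : a.map (fun x => x + 1) = a := by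
    refine map_withDensity_rnDeriv_eq (T := fun μ => μ.map fun x => x + 1)
      (fun μ ν => Measure.map_add _ _ (by fun_prop)) ?_ ?_ h.map_add_one
    · rintro μ ⟨s, hs, hμ, hv⟩
      refine ⟨(fun x => x - 1) ⁻¹' s, hs.preimage (by fun_prop), ?_, ?_⟩
      · rw [Measure.map_apply (by fun_prop) (hs.preimage (by fun_prop)), ← Set.preimage_comp]
        convert hμ
        ext x
        simp
      · rw [← Set.preimage_compl]
        simpa only [sub_eq_add_neg, measure_preimage_add_right] using hv
    · intro μ hμ
      refine Measure.AbsolutelyContinuous.mk fun s hs h0 => ?_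
      rw [Measure.map_apply (by fun_prop) hs]
      exact hμ (by rwa [measure_preimage_add_right])
  have hper : IsPeriodicMeasure a := ⟨hshift, ne_top_of_le_ne_top h.measure_Ico_ne_top
    (Measure.withDensity_rnDeriv_le μ volume _)⟩
  have hzero : periodCoeff a 0 = 0 :=
    (isRenormalised_periodCoeff hm hper hstep).apply_zero_eq_zero hk hl
      (tendsto_periodCoeff_withDensity (Measure.measurable_rnDeriv _ _)
        (Measure.rnDeriv_lt_top _ _))
  rw [IsPeriodicMeasure.periodCoeff_zero] at hzero
  have ha0 : a = 0 := hper.eq_zero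
    ((measureReal_eq_zero_iff hper.measure_Ico_ne_top).1 (by exact_mod_cast hzero))
  rw [← μ.singularPart_add_rnDeriv volume, ← ha, ha0, add_zero]
  exact Measure.mutuallySingular_singularPart _ _

/-! ### Absence of atoms -/

theorem Complex.eq_one_of_two_le_norm_one_add {z : ℂ} (hz : ‖z‖ = 1) (h : 2 ≤ ‖1 + z‖) :
    z = 1 := by
  have h1 : ‖1 + z‖ ^ 2 = 2 + 2 * z.re := by
    have h2 : ‖z‖ ^ 2 = z.re ^ 2 + z.im ^ 2 := by rw [Complex.sq_norm, Complex.normSq_apply]; ring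
    rw [hz] at h2
    rw [Complex.sq_norm, Complex.normSq_apply]
    simp only [Complex.add_re, Complex.one_re, Complex.add_im, Complex.one_im, zero_add]
    linarith
  have h3 : 1 ≤ z.re := by nlinarith
  have h4 : z.re = 1 := le_antisymm (hz ▸ Complex.re_le_norm z) h3
  have h5 : z.re ^ 2 + z.im ^ 2 = 1 := by
    have h2 : ‖z‖ ^ 2 = z.re ^ 2 + z.im ^ 2 := by rw [Complex.sq_norm, Complex.normSq_apply]; ring
    rw [← h2, hz]; norm_num
  refine Complex.ext h4 ?_
  rw [h4] at h5
  rw [Complex.one_im]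
  nlinarith

/-- If the weight is maximal at `x`, then all terms of the trigonometric polynomial are aligned. -/
theorem gtmSign_mul_fourierChar_eq_one {k l : ℕ} (hk : 1 ≤ k) {x : ℝ} (hx : 1 ≤ gtmWeight k l x)
    {a : ℕ} (ha : a < k + l) : ((gtmSign k a : ℤ) : ℂ) * 𝐞 (a * x) = 1 := by
  set z : ℕ → ℂ := fun a => ((gtmSign k a : ℤ) : ℂ) * 𝐞 (a * x) with hz
  have hz1 : ∀ a, ‖z a‖ = 1 := fun a => by
    simp only [hz, norm_mul, norm_units_cast, Circle.norm_coe, mul_one]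
  have hz0 : z 0 = 1 := by simp [hz, gtmSign_zero hk]
  change z a = 1
  rcases Nat.eq_zero_or_pos a with rfl | ha0
  · exact hz0
  refine Complex.eq_one_of_two_le_norm_one_add (hz1 a) ?_
  have hpos : (0 : ℝ) < (k + l : ℕ) := by exact_mod_cast (by omega : 0 < k + l)
  have h1 : ((k + l : ℕ) : ℝ) ≤ ‖∑ a ∈ Finset.range (k + l), z a‖ := by
    have h2 : 1 ≤ ‖gtmPolynomial k l x‖ := by
      by_contra! h
      exact absurd hx (not_le.2 (pow_lt_one₀ (norm_nonneg _) h two_ne_zero))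
    rwa [gtmPolynomial, norm_div, Complex.norm_natCast, one_le_div hpos] at h2
  have hmem0 : 0 ∈ Finset.range (k + l) := Finset.mem_range.2 (by omega)
  have hmem : a ∈ (Finset.range (k + l)).erase 0 :=
    Finset.mem_erase.2 ⟨ha0.ne', Finset.mem_range.2 ha⟩
  rw [← Finset.add_sum_erase _ _ hmem0, ← Finset.add_sum_erase _ _ hmem, ← add_assoc, hz0] at h1
  have h3 : ‖∑ b ∈ ((Finset.range (k + l)).erase 0).erase a, z b‖ ≤ ((k + l : ℕ) : ℝ) - 2 := by
    refine (norm_sum_le _ _).trans (le_of_eq ?_)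
    simp only [hz1, Finset.sum_const, nsmul_eq_mul, mul_one]
    rw [Finset.card_erase_of_mem hmem, Finset.card_erase_of_mem hmem0, Finset.card_range,
      Nat.cast_sub (by omega), Nat.cast_sub (by omega)]
    push_cast
    ring
  linarith [norm_add_le (1 + z a) (∑ b ∈ ((Finset.range (k + l)).erase 0).erase a, z b)]

/-- The weight cannot be maximal both at `x` and at `m x`. -/
theorem gtmWeight_mul_gtmWeight_lt_one {k l : ℕ} (hk : 1 ≤ k) (hl : 1 ≤ l) (x : ℝ) :
    gtmWeight k l x * gtmWeight k l ((k + l : ℕ) * x) < 1 := by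
  by_contra! h
  have h0 := gtmWeight_nonneg k l
  have h1 := gtmWeight_le_one k l
  have hx : 1 ≤ gtmWeight k l x := h.trans (mul_le_of_le_one_right (h0 _) (h1 _))
  have hmx : 1 ≤ gtmWeight k l ((k + l : ℕ) * x) := h.trans (mul_le_of_le_one_left (h0 _) (h1 _))
  have e1 := gtmSign_mul_fourierChar_eq_one hk hx (a := 1) (by omega)
  have e2 := gtmSign_mul_fourierChar_eq_one hk hx (a := k + l - 1) (by omega)
  have e3 := gtmSign_mul_fourierChar_eq_one hk hmx (a := 1) (by omega)
  have hlast : gtmSign k (k + l - 1) = -1 := if_neg (by omega)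
  have hexp : (𝐞 ((k + l : ℕ) * x) : ℂ) = 𝐞 (((k + l - 1 : ℕ) : ℝ) * x) * 𝐞 x := by
    rw [← coe_fourierChar_add]
    congr 2
    rw [Nat.cast_sub (by omega)]
    push_cast
    ring
  rw [hlast] at e2
  simp only [Nat.cast_one, one_mul] at e1 e3
  rw [hexp] at e3
  have e4 : (𝐞 (((k + l - 1 : ℕ) : ℝ) * x) : ℂ) = -1 := by
    have : -(𝐞 (((k + l - 1 : ℕ) : ℝ) * x) : ℂ) = 1 := by simpa using e2
    rw [← this, neg_neg]
  rw [e4, mul_left_comm, e1] at e3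
  norm_num at e3

theorem rieszStep_singleton {k l : ℕ} (hm : 0 < k + l) (μ : Measure ℝ) (x : ℝ) :
    rieszStep k l μ {x} = ENNReal.ofReal (gtmWeight k l x) * μ {(k + l : ℕ) * x} := by
  have hm0 : ((k + l : ℕ) : ℝ) ≠ 0 := by positivity
  rw [rieszStep, withDensity_apply _ (measurableSet_singleton x), lintegral_singleton,
    Measure.map_apply (by fun_prop) (measurableSet_singleton x)]
  congr 2
  ext y
  simp only [Set.mem_preimage, Set.mem_singleton_iff]
  rw [div_eq_iff hm0, mul_comm]

/-- A self-similar periodic measure has no atoms: passing from `x` to `m ^ 2 x` multiplies the mass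
of an atom by at least a constant greater than `1`. -/
theorem measure_singleton_eq_zero_of_rieszStep_eq {k l : ℕ} (hk : 1 ≤ k) (hl : 1 ≤ l)
    {μ : Measure ℝ} (h : IsPeriodicMeasure μ) (hμ : rieszStep k l μ = μ) (x : ℝ) : μ {x} = 0 := by
  have hm : 0 < k + l := by omega
  set g : ℝ → ℝ := fun x => gtmWeight k l x * gtmWeight k l ((k + l : ℕ) * x) with hg
  have hgc : Continuous g :=
    (continuous_gtmWeight k l).mul ((continuous_gtmWeight k l).comp (by fun_prop))
  have hper : Function.Periodic (gtmWeight k l) 1 := gtmWeight_add_one k l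
  have hgp : Function.Periodic g 1 := by
    intro x
    have h1 : gtmWeight k l ((k + l : ℕ) * (x + 1)) = gtmWeight k l ((k + l : ℕ) * x) := by
      rw [mul_add]
      exact hper.nat_mul (k + l) _
    simp only [hg, h1, gtmWeight_add_one]
  obtain ⟨x₀, -, hx₀⟩ := (isCompact_Icc (a := (0 : ℝ)) (b := 1)).exists_isMaxOn
    (Set.nonempty_Icc.2 zero_le_one) hgc.continuousOn
  have hmax : ∀ x, g x ≤ g x₀ := by
    intro x
    obtain ⟨y, hy, hxy⟩ := hgp.exists_mem_Ico₀ one_pos x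
    rw [hxy]
    exact hx₀ (Set.Ico_subset_Icc_self hy)
  have hstep : ∀ x, μ {x} = ENNReal.ofReal (gtmWeight k l x) * μ {(k + l : ℕ) * x} := fun x => by
    conv_lhs => rw [← hμ]
    exact rieszStep_singleton hm μ x
  have hpow : ∀ (n : ℕ) (x : ℝ), μ {x} ≤ ENNReal.ofReal (g x₀) ^ n * μ (Set.Ico 0 1) := by
    intro n
    induction n with
    | zero =>
      intro x
      rw [pow_zero, one_mul, ← h.measure_Ico_intCast ⌊x⌋]
      exact measure_mono (Set.singleton_subset_iff.2 ⟨Int.floor_le x, Int.lt_floor_add_one x⟩)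
    | succ n ih =>
      intro x
      rw [hstep x, hstep, ← mul_assoc, ← ENNReal.ofReal_mul (gtmWeight_nonneg k l _), pow_succ',
        mul_assoc]
      gcongr
      · exact hmax x
      · exact ih _
  have hlt : ENNReal.ofReal (g x₀) < 1 :=
    ENNReal.ofReal_lt_one.2 (gtmWeight_mul_gtmWeight_lt_one hk hl x₀)
  have hlim : Tendsto (fun n : ℕ => ENNReal.ofReal (g x₀) ^ n * μ (Set.Ico 0 1)) atTop (𝓝 0) := by
    simpa using ENNReal.Tendsto.mul_const (ENNReal.tendsto_pow_atTop_nhds_zero_of_lt_one hlt)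
      (Or.inr h.measure_Ico_ne_top)
  exact le_antisymm (ge_of_tendsto' hlim fun n => hpow n x) (zero_le)

/-! ### The diffraction measure -/

theorem IsAutocorrelation.unique {c : ℤ → ℂ} {γ γ' : ComplexRadonMeasure}
    (h : IsAutocorrelation c γ) (h' : IsAutocorrelation c γ') : γ = γ' :=
  ComplexRadonMeasure.ext (LinearMap.ext fun g => tendsto_nhds_unique (h g) (h' g))

theorem theorem3p4 (k l : ℕ) (hk : 1 ≤ k) (hl : 1 ≤ l) :
    ∃ (γ : ComplexRadonMeasure) (γhat : Measure ℝ),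
      (∀ w ∈ gtmHull k l, ∀ γ' : ComplexRadonMeasure,
        IsAutocorrelation (combWeights w) γ' ↔ γ' = γ) ∧
      (∀ μ : Measure ℝ, IsFourierTransform γ μ ↔ μ = γhat) ∧
      (∀ w ∈ gtmHull k l, ∀ μ : Measure ℝ,
        IsDiffractionMeasure (combWeights w) μ ↔ μ = γhat) ∧
      IsPurelySingularContinuous γhat := by
  have hm : 0 < k + l := by omega
  obtain ⟨Γ, hΓ, hstep, hmass⟩ := exists_isPeriodicMeasure_rieszStep_eq hm
  have h0 : periodCoeff Γ 0 = 1 := by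
    rw [IsPeriodicMeasure.periodCoeff_zero, Measure.real, hmass]; simp
  have hauto : ∀ w ∈ gtmHull k l, ∀ γ' : ComplexRadonMeasure,
      IsAutocorrelation (combWeights w) γ' ↔ γ' = diracComb (periodCoeff Γ) := by
    intro w hw γ'
    have h1 : IsAutocorrelation (combWeights w) (diracComb (periodCoeff Γ)) :=
      isAutocorrelation_diracComb hk hl (isRenormalised_periodCoeff hm hΓ hstep) h0
        (periodCoeff_neg_of_rieszStep_eq hk hl hΓ hstep) hw
    exact ⟨fun h => h.unique h1, fun h => h ▸ h1⟩
  have hfourier : ∀ μ : Measure ℝ,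
      IsFourierTransform (diracComb (periodCoeff Γ)) μ ↔ μ = Γ := fun μ =>
    ⟨fun h => h.unique hΓ.isFourierTransform, fun h => h ▸ hΓ.isFourierTransform⟩
  refine ⟨diracComb (periodCoeff Γ), Γ, hauto, hfourier, fun w hw μ => ?_, ?_,
    measure_singleton_eq_zero_of_rieszStep_eq hk hl hΓ hstep,
    mutuallySingular_of_rieszStep_eq hk hl hΓ hstep⟩
  · constructor
    · rintro ⟨γ', h1, h2⟩
      rw [(hauto w hw γ').1 h1] at h2
      exact (hfourier μ).1 h2
    · intro h
      exact ⟨_, (hauto w hw _).2 rfl, (hfourier μ).2 h⟩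
  · rintro rfl
    simp at hmass
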